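/- Let $\mathcal G$ be a connected undirected graph without self-loops on the agents $1,\dots,N$, let $\mathcal N_i$ be the set of neighbors of $i$, and let $P=[p_{ij}]$ be a symmetric weighted adjacency matrix: $p_{ij}>0$ if $j\in\mathcal N_i$ and $p_{ij}=0$ otherwise. Let $L=\mathrm{diag}\big(\sum_{j\in\mathcal N_i}p_{ij}\big)_i-P$ be the Laplace matrix. Agent $i$ is, from time $k\ge 1$ on and with arbitrary (random) initial data, either a Hammerstein system $v_{i,k}=f_i(u_{i,k})$, $C_i(z)y_{i,k+1}=D_i(z)v_{i,k}$, or a Wiener system $C_i(z)v_{i,k+1}=D_i(z)u_{i,k}$, $y_{i,k+1}=f_i(v_{i,k+1})$. Here $z$ is the backward shift, and $C_i,D_i$ are real polynomials with constant term $1$, whose degrees may depend on $i$. Put $c_i=C_i(1)$, $d_i=D_i(1)$, and $h_i(u)=\frac{d_i}{c_i}f_i(u)$ in the Hammerstein case, $h_i(u)=f_i(\frac{d_i}{c_i}u)$ in the Wiener case. Write $h(u)=(h_1(u_1),\dots,h_N(u_N))^T$, $g(u)=-Lh(u)$, and $J=\{u\in\mathbb R^N: g(u)=0\}=\{u: h(u)\in\mathrm{Span}\{\mathbf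 1\}\}$. Assume: (A1) all complex roots of each $C_i$ have modulus $>1$; (A2) each $f_i$ is continuous; for some $\mu>0$, $|f_i(u)|=O(|u|^\mu)$ as $|u|\to\infty$ for all $i$; and each $h_i$ is strictly increasing with range $\mathbb R$; (A3) the noises $\epsilon_{ij,k}$ ($i\in\{1,\dots,N\}$, $j\in\mathcal N_i$, $k\ge1$) are mutually independent random variables with $\mathbb E\epsilon_{ij,k}=0$ and $\sup_k\mathbb E|\epsilon_{ij,k}|^2<\infty$ for each pair $(i,j)$; (A4) $\mathcal G$ is connected. Let $a_k=1/k$ and $M_m=\ln(m+c_M)$, where $c_M>0$ and $u_1^*,\dots,u_N^*\in\mathbb R$ satisfy $|u_i^*|<M_0$ for all $i$. The inputs are generated, from arbitrary initial inputs $u_{i,1}$ and $\sigma_{i,1}=0$, by the following rules for $k\ge1$: $$\sigma'_{i,k}=\max\{\sigma_{i,k},\ \sigma_{j,k}: j\in\mathcal N_i\},\qquad u'_{i,k}=\begin{cases}u_{i,k},&\sigma'_{i,k}=\sigma_{i,k},\\ u_i^*,&\sigma'_{i,k}>\sigma_{i,k},\end{cases}$$ $$O_{i,k+1}=\sum_{j\in\mathcal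 N_i}p_{ij}\big(y_{j,k+1}+\epsilon_{ij,k+1}-y_{i,k+1}\big),$$ $$(u_{i,k+1},\sigma_{i,k+1})=\begin{cases}(u'_{i,k}+a_kO_{i,k+1},\ \sigma'_{i,k}),&|u'_{i,k}+a_kO_{i,k+1}|<M_{\sigma'_{i,k}},\\ (u_i^*,\ \sigma'_{i,k}+1),&|u'_{i,k}+a_kO_{i,k+1}|\ge M_{\sigma'_{i,k}}.\end{cases}$$ Put $\bar\sigma_k=\max_i\sigma_{i,k}$, and let $\bar u_{i,k}=u_i^*$ if $\sigma_{i,k}<\bar\sigma_k$, $\bar u_{i,k}=u_{i,k}$ if $\sigma_{i,k}=\bar\sigma_k$. With $\bar u_k=(\bar u_{1,k},\dots,\bar u_{N,k})^T$, let $\bar\epsilon_{i,k+1}=-g_i(\bar u_k)$ if $\sigma'_{i,k}<\bar\sigma_k$, and $\bar\epsilon_{i,k+1}=O_{i,k+1}-g_i(\bar u_k)$ if $\sigma'_{i,k}=\bar\sigma_k$. Then there are a real random variable $y^0$ and a random vector $u^0$ in $\mathbb R^N$ such that, almost surely: - $y_{i,k}\to y^0$ and $u_{i,k}\to u^0_i$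 as $k\to\infty$, for all $i$, and $y^0\mathbf 1=h(u^0)$; - $\bar\sigma_k$ is eventually constant, equal to some $\bar\sigma<\infty$; with $K\ge1$ the smallest time such that $\bar\sigma_k=\bar\sigma$ for all $k\ge K$, the series $\sum_{s=K}^{\infty}a_s\mathbf 1^T\bar\epsilon_{s+1}$ converges, and $u^0$ is the unique point of $J$ on the hyperplane $$\Big\{u\in\mathbb R^N:\ \mathbf 1^Tu=\mathbf 1^T\hat u+\sum_{s=K}^{\infty}a_s\mathbf 1^T\bar\epsilon_{s+1}\Big\},$$ where $\hat u=u^*$ if $\bar\sigma\ge1$, and $\hat u=(u_{1,1},\dots,u_{N,1})^T$ if $\bar\sigma=0$. -/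

import Mathlib

open Filter Topology MeasureTheory ProbabilityTheory

namespace NetConsensus

/-- `A(z) x` at time `k`, where `z` is the backward shift `(z x)_k = x_{k-1}`. -/
noncomputable def shiftApply (A : Polynomial ℝ) (x : ℤ → ℝ) (k : ℤ) : ℝ :=
  ∑ s ∈ Finset.range (A.natDegree + 1), A.coeff s * x (k - s)

/-- The two kinds of single-input single-output systems. -/
inductive Kind where
  | hammerstein
  | wiener

/-- An agent: linear part given by `C(z) = 1 + c₁ z + ⋯ + c_p z^p` and
`D(z) = 1 + d₁ z + ⋯ + d_q z^q`, and a static nonlinearity `f`. -/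
structure Agent where
  kind : Kind
  C : Polynomial ℝ
  D : Polynomial ℝ
  f : ℝ → ℝ
  C_zero : C.coeff 0 = 1
  D_zero : D.coeff 0 = 1

/-- The roots of `C(z)` lie outside the closed unit disk. -/
def Agent.Stable (A : Agent) : Prop :=
  ∀ z : ℂ, Polynomial.aeval z A.C = 0 → 1 < ‖z‖

/-- The steady-state characteristic `h`. -/
noncomputable def Agent.h (A : Agent) (x : ℝ) : ℝ :=
  match A.kind with
  | Kind.hammerstein => A.D.eval 1 / A.C.eval 1 * A.f x
  | Kind.wiener => A.f (A.D.eval 1 / A.C.eval 1 * x)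

/-- Input `u`, internal variable `v` and output `y` satisfy the system equations from time `1` on;
the values at earlier times which enter these equations are arbitrary initial data. -/
def Agent.Dynamics (A : Agent) (u v y : ℤ → ℝ) : Prop :=
  match A.kind with
  | Kind.hammerstein => ∀ k : ℤ, 1 ≤ k →
      v k = A.f (u k) ∧ shiftApply A.C y (k + 1) = shiftApply A.D v k
  | Kind.wiener => ∀ k : ℤ, 1 ≤ k →
      shiftApply A.C v (k + 1) = shiftApply A.D u k ∧ y (k + 1) = A.f (v (k + 1))

/-- An undirected graph without self-loops on `N` nodes, with a (symmetric) weighted adjacency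
matrix: `p_ij > 0` exactly on the edges. -/
structure Network (N : ℕ) where
  graph : SimpleGraph (Fin N)
  P : Matrix (Fin N) (Fin N) ℝ
  P_pos : ∀ i j, graph.Adj i j → 0 < P i j
  P_zero : ∀ i j, ¬ graph.Adj i j → P i j = 0
  P_symm : ∀ i j, P i j = P j i

/-- The set of neighbors of agent `i`. -/
noncomputable def Network.nbrs {N : ℕ} (G : Network N) (i : Fin N) : Finset (Fin N) :=
  open Classical in Finset.univ.filter fun j => G.graph.Adj i j

/-- The Laplace matrix `L = D - P`, with `D` the diagonal matrix of the degrees `p_i`. -/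
noncomputable def Network.lap {N : ℕ} (G : Network N) : Matrix (Fin N) (Fin N) ℝ :=
  Matrix.diagonal (fun i => ∑ j ∈ G.nbrs i, G.P i j) - G.P

/-- The regression function `g(u) = -L h(u)`. -/
noncomputable def regression {N : ℕ} (G : Network N) (A : Fin N → Agent) (w : Fin N → ℝ) :
    Fin N → ℝ :=
  -(G.lap.mulVec fun i => (A i).h (w i))

/-- The signals of the closed loop along one sample: control inputs, internal variables, outputs,
and truncation numbers. -/
structure Trajectory (N : ℕ) where
  u : Fin N → ℤ → ℝ
  v : Fin N → ℤ → ℝ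
  y : Fin N → ℤ → ℝ
  σ : Fin N → ℕ → ℕ

/-- Step size `a_k = 1/k`. -/
noncomputable def stepSize (k : ℕ) : ℝ := 1 / (k : ℝ)

/-- Truncation bound `M_m = ln (m + c_M)`. -/
noncomputable def bound (cM : ℝ) (m : ℕ) : ℝ := Real.log ((m : ℝ) + cM)

section Algorithm

variable {N : ℕ}

/-- `σ'_{i,k}`: the largest truncation number among agent `i` and its neighbors at time `k`. -/
noncomputable def sigmaPrime (G : Network N) (T : Trajectory N) (i : Fin N) (k : ℕ) : ℕ :=
  max ((G.nbrs i).sup fun j => T.σ j k) (T.σ i k)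

/-- `u'_{i,k}`: the input, reset to `u_i^*` if a neighbor has a larger truncation number. -/
noncomputable def uPrime (G : Network N) (ustar : Fin N → ℝ) (T : Trajectory N) (i : Fin N)
    (k : ℕ) : ℝ :=
  if sigmaPrime G T i k = T.σ i k then T.u i k else ustar i

/-- `z_{ij,k}`: the noisy observation of the output of agent `j`. -/
def observed (ε : Fin N → Fin N → ℕ → ℝ) (T : Trajectory N) (i j : Fin N) (k : ℕ) : ℝ :=
  T.y j k + ε i j k

/-- `innovation … i k` is `O_{i,k} = ∑_{j ∈ N_i} p_ij (z_{ij,k} - y_{i,k})`. -/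
noncomputable def innovation (G : Network N) (ε : Fin N → Fin N → ℕ → ℝ) (T : Trajectory N)
    (i : Fin N) (k : ℕ) : ℝ :=
  ∑ j ∈ G.nbrs i, G.P i j * (observed ε T i j k - T.y i k)

/-- The value `u'_{i,k} + a_k O_{i,k+1}` before truncation. -/
noncomputable def candidate (G : Network N) (ustar : Fin N → ℝ) (ε : Fin N → Fin N → ℕ → ℝ)
    (T : Trajectory N) (i : Fin N) (k : ℕ) : ℝ :=
  uPrime G ustar T i k + stepSize k * innovation G ε T i (k + 1)

/-- `T` is a closed-loop trajectory of the network of agents `A` under the distributed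
stochastic approximation control with expanding truncations, for the noise sample `ε`. -/
structure ClosedLoop (G : Network N) (A : Fin N → Agent) (ustar : Fin N → ℝ) (cM : ℝ)
    (ε : Fin N → Fin N → ℕ → ℝ) (T : Trajectory N) : Prop where
  dynamics : ∀ i, (A i).Dynamics (T.u i) (T.v i) (T.y i)
  sigma_one : ∀ i, T.σ i 1 = 0
  keep : ∀ i (k : ℕ), 1 ≤ k →
    |candidate G ustar ε T i k| < bound cM (sigmaPrime G T i k) →
      T.u i (k + 1) = candidate G ustar ε T i k ∧ T.σ i (k + 1) = sigmaPrime G T i k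
  truncate : ∀ i (k : ℕ), 1 ≤ k →
    bound cM (sigmaPrime G T i k) ≤ |candidate G ustar ε T i k| →
      T.u i (k + 1) = ustar i ∧ T.σ i (k + 1) = sigmaPrime G T i k + 1

/-- `σ̄_k`: the largest truncation number in the network at time `k`. -/
def sigmaBar (T : Trajectory N) (k : ℕ) : ℕ := Finset.univ.sup fun i => T.σ i k

/-- Auxiliary inputs `ū_{i,k}`: equal to `u_i^*` as long as agent `i` has not reached the largest
truncation number of the network, and to `u_{i,k}` otherwise. -/
noncomputable def uBar (ustar : Fin N → ℝ) (T : Trajectory N) (k : ℕ) (i : Fin N) : ℝ :=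
  if T.σ i k < sigmaBar T k then ustar i else T.u i k

/-- Auxiliary noise: `noiseBar … k i` is `ε̄_{i,k+1}`. It is `-g_i(ū_k)` as long as the largest
truncation number of the network is not known to agent `i` or a neighbor of it, and
`O_{i,k+1} - g_i(ū_k)` otherwise. -/
noncomputable def noiseBar (G : Network N) (A : Fin N → Agent) (ustar : Fin N → ℝ)
    (ε : Fin N → Fin N → ℕ → ℝ) (T : Trajectory N) (k : ℕ) (i : Fin N) : ℝ :=
  (if sigmaPrime G T i k < sigmaBar T k then 0 else innovation G ε T i (k + 1))
    - regression G A (uBar ustar T k) i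

/-- `K ≥ 1` is the smallest time from which on the largest truncation number of the network stays
at its final value `m`. -/
def TruncationsCease (T : Trajectory N) (m K : ℕ) : Prop :=
  IsLeast {k : ℕ | 1 ≤ k ∧ ∀ l, k ≤ l → sigmaBar T l = m} K

/-- The vector from which the auxiliary inputs start after the last truncation, given the final
truncation number `m`: `u^*` if there has been a truncation (`m ≥ 1`), and the initial input `u_1`
otherwise. -/
noncomputable def restart (ustar : Fin N → ℝ) (T : Trajectory N) (m : ℕ) (i : Fin N) : ℝ :=
  if m = 0 then T.u i 1 else ustar i

end Algorithm

end NetConsensus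

/-! Probability enters only once: by martingale convergence the series `∑ a_s ε_{ij,s+1}` converges
almost surely on every edge (`ae_exists_tendsto_noise`). The rest is deterministic, for each such
sample (`RegularPath`).

Let `E_k` be the tail of the accumulated noise and `z = ū + E` (`corrected`). As long as every agent
knows the largest truncation number and that number does not change, `z_{k+1} = z_k - a_k L
y_{k+1}`. Since `1ᵀL = 0`, the sum of the coordinates of `z` is conserved, so `z` stays on a
hyperplane. The Lyapunov function is `V(z) = ∑ᵢ ∫₀^{zᵢ} hᵢ`: it is strictly convex and coercive
because the `hᵢ` increase strictly from `-∞` to `∞`. If `y_{k+1}` is replaced by `h(z_k)`, then `V`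
falls by `a_k hᵀLh` up to a small error. By connectedness `hᵀLh` vanishes only where all `hᵢ` agree;
each hyperplane contains exactly one such point, and it minimizes `V` there. As `∑ a_k` diverges,
`V(z_k)` tends to this minimum, `z_k` to the minimizer, and, as `E_k → 0`, so does `u_k`.

Replacing `y_{k+1}` by `h(z_k)` rests on a separation of time scales. Truncation numbers grow at
most linearly and the bounds `M_m` logarithmically, so inputs grow more slowly than any power and
outputs are `O(k^(1/4))`. During the last `√k` steps `z` then moves by only `O(k^(-1/4))`, whereas a
stable filter forgets its past geometrically in that time (`filter_tracking`, `exists_movement_le`,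
`exists_descent`).

Truncations stop (`RegularPath.exists_sigmaBar_le`) because a sufficiently high level `m`, once
reached, is never left. At that moment `ū = u^*` and the time already exceeds `m`, hence all the
thresholds above. First `z` stays close to `u^*` until the news has spread and the filters have
settled; afterwards the descent of `V` confines `z` to a bounded set lying inside `M_m`.

The limit is identified by summing the increments of `1ᵀū` from the last truncation on: they are
exactly `a_s 1ᵀε̄_{s+1}`. -/

namespace NetConsensus

/-! ### Stable linear filters -/

/-- The backward shift on two-sided sequences. -/
def backShift (R : Type*) [CommRing R] : (ℤ → R) →ₗ[R] (ℤ → R) where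
  toFun x k := x (k - 1)
  map_add' _ _ := rfl
  map_smul' _ _ := rfl

lemma backShift_pow_apply {R : Type*} [CommRing R] (s : ℕ) (x : ℤ → R) (k : ℤ) :
    ((backShift R) ^ s) x k = x (k - s) := by
  induction s generalizing x k with
  | zero => simp
  | succ s ih =>
    rw [pow_succ, Module.End.mul_apply, ih]
    simp only [backShift, LinearMap.coe_mk, AddHom.coe_mk]
    congr 1
    push_cast
    ring

lemma ofReal_shiftApply (A : Polynomial ℝ) (x : ℤ → ℝ) (k : ℤ) :
    Polynomial.aeval (backShift ℂ) (A.map (algebraMap ℝ ℂ)) (fun l => (x l : ℂ)) k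
      = ((shiftApply A x k : ℝ) : ℂ) := by
  rw [Polynomial.aeval_eq_sum_range, Polynomial.natDegree_map, LinearMap.sum_apply,
    Finset.sum_apply, shiftApply]
  push_cast
  refine Finset.sum_congr rfl fun s _ => ?_
  rw [LinearMap.smul_apply, Pi.smul_apply, backShift_pow_apply]
  simp

/-- A recursion whose characteristic polynomial has all its roots outside the closed unit disk
is stable: the effect of the initial values decays geometrically. -/
theorem complex_filter_bound (d : ℕ) : ∀ P : Polynomial ℂ, P.natDegree = d → P ≠ 0 →
    (∀ z, P.IsRoot z → 1 < ‖z‖) →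
    ∃ K r : ℝ, 0 ≤ K ∧ 0 < r ∧ r < 1 ∧ ∀ (x : ℤ → ℂ) (k₀ : ℤ) (n : ℕ) (W X : ℝ), 0 ≤ W →
      (∀ j : ℕ, 1 ≤ j → j ≤ n → ‖Polynomial.aeval (backShift ℂ) P x (k₀ + j)‖ ≤ W) →
      (∀ j : ℕ, j ≤ d → ‖x (k₀ - j)‖ ≤ X) → ‖x (k₀ + n)‖ ≤ K * (W + r ^ n * X) := by
  induction d with
  | zero =>
    intro P hd hP _
    obtain ⟨b, rfl⟩ : ∃ b, P = Polynomial.C b := ⟨_, Polynomial.eq_C_of_natDegree_eq_zero hd⟩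
    have hb : b ≠ 0 := by rintro rfl; simp at hP
    have hb' : 0 < ‖b‖ := norm_pos_iff.2 hb
    refine ⟨1 + ‖b‖⁻¹, 1 / 2, by positivity, by norm_num, by norm_num, ?_⟩
    intro x k₀ n W X hW hw hx
    have hX : ‖x k₀‖ ≤ X := by simpa using hx 0 le_rfl
    have hX0 : 0 ≤ X := (norm_nonneg _).trans hX
    rcases Nat.eq_zero_or_pos n with rfl | hn
    · have : 0 ≤ ‖b‖⁻¹ * (W + X) := by positivity
      simp only [Nat.cast_zero, add_zero, pow_zero, one_mul]
      nlinarith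
    · have h := hw n hn le_rfl
      rw [Polynomial.aeval_C, Module.algebraMap_end_apply, Pi.smul_apply, smul_eq_mul,
        norm_mul] at h
      have h2 : ‖x (k₀ + n)‖ ≤ ‖b‖⁻¹ * W := by
        rw [inv_mul_eq_div, le_div_iff₀ hb', mul_comm]; exact h
      have h3 : 0 ≤ (1 / 2 : ℝ) ^ n * X := by positivity
      have h4 : 0 ≤ ‖b‖⁻¹ * ((1 / 2 : ℝ) ^ n * X) := by positivity
      nlinarith
  | succ d ih =>
    intro P hd hP hroot
    obtain ⟨ζ, hζ⟩ := Complex.exists_root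
      (Polynomial.natDegree_pos_iff_degree_pos.1 (by omega : 0 < P.natDegree))
    obtain ⟨Q, rfl⟩ := Polynomial.dvd_iff_isRoot.2 hζ
    have hQ : Q ≠ 0 := by rintro rfl; simp at hP
    have hdQ : Q.natDegree = d := by
      rw [Polynomial.natDegree_mul (Polynomial.X_sub_C_ne_zero ζ) hQ,
        Polynomial.natDegree_X_sub_C] at hd
      omega
    obtain ⟨K, r, hK, hr, hr1, hKr⟩ := ih Q hdQ hQ fun z hz => hroot z (by
      rw [Polynomial.IsRoot.def, Polynomial.eval_mul, hz, mul_zero])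
    have hζ1 : 1 < ‖ζ‖ := hroot ζ hζ
    have hζ0 : 0 < ‖ζ‖ := by linarith
    set ρ : ℝ := ‖ζ‖⁻¹ with hρ
    have hρ0 : 0 < ρ := by positivity
    have hρ1 : ρ < 1 := inv_lt_one_of_one_lt₀ hζ1
    -- The new rate must lie strictly above `ρ`: dividing by the factor `X - ζ` adds a first-order
    -- recursion with contraction factor `ρ`, and forcing that decays at rate `r'` keeps this rate
    -- only if `r' > ρ`. The constant `M` is chosen to close the induction over `l` below.
    set r' : ℝ := max r ((1 + ρ) / 2) with hr'
    have hrr' : r ≤ r' := le_max_left _ _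
    have hρr' : ρ < r' := lt_of_lt_of_le (by linarith) (le_max_right _ _)
    have hr'1 : r' < 1 := max_lt hr1 (by linarith)
    set M : ℝ := K * (1 + ‖ζ‖) / (r' - ρ) with hM
    have hgap : 0 < r' - ρ := by linarith
    have hM0 : 0 ≤ M := by positivity
    have hMeq : M * (r' - ρ) = K * (1 + ‖ζ‖) := by rw [hM]; field_simp
    refine ⟨1 + M, r', by positivity, by linarith, hr'1, ?_⟩
    intro x k₀ n W X hW hw hx
    have hX0 : 0 ≤ X := (norm_nonneg _).trans (hx 0 (by omega))
    -- `x' = (z - ζ) x`, so the cofactor `Q` filters `x'` to the same signal and the induction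
    -- hypothesis bounds `x'`. Then `x` is recovered from `x_k = ζ⁻¹ (x_{k-1} - x'_k)`, a
    -- contraction since `1 < ‖ζ‖`.
    set x' : ℤ → ℂ := fun k => x (k - 1) - ζ * x k with hx'
    have hfac : Polynomial.aeval (backShift ℂ) ((Polynomial.X - Polynomial.C ζ) * Q) x
        = Polynomial.aeval (backShift ℂ) Q x' := by
      rw [mul_comm, map_mul, Module.End.mul_apply]
      congr 1
      ext k
      simp [backShift, hx', Module.algebraMap_end_apply]
    have hx'X : ∀ j : ℕ, j ≤ d → ‖x' (k₀ - j)‖ ≤ (1 + ‖ζ‖) * X := by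
      intro j hj
      have h1 := hx (j + 1) (by omega)
      have h2 := hx j (by omega)
      have e : k₀ - ((j + 1 : ℕ) : ℤ) = k₀ - j - 1 := by push_cast; ring
      rw [e] at h1
      calc ‖x' (k₀ - j)‖ ≤ ‖x (k₀ - j - 1)‖ + ‖ζ * x (k₀ - j)‖ := norm_sub_le _ _
        _ ≤ X + ‖ζ‖ * X := by rw [norm_mul]; gcongr
        _ = _ := by ring
    have key : ∀ l : ℕ, l ≤ n → ‖x (k₀ + l)‖ ≤ (1 + M) * (W + r' ^ l * X) := by
      intro l
      induction l with
      | zero =>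
        intro _
        have h0 : ‖x k₀‖ ≤ X := by simpa using hx 0 (by omega)
        have : 0 ≤ M * (W + X) := by positivity
        simp only [Nat.cast_zero, add_zero, pow_zero, one_mul]
        nlinarith
      | succ l ihl =>
        intro hl
        have h1 := ihl (by omega)
        have h2 := hKr x' k₀ (l + 1) W ((1 + ‖ζ‖) * X) hW
          (fun j hj1 hj2 => by rw [← hfac]; exact hw j hj1 (by omega)) hx'X
        have e : k₀ + ((l + 1 : ℕ) : ℤ) - 1 = k₀ + l := by push_cast; ring
        have h3 : x (k₀ + ((l + 1 : ℕ) : ℤ))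
            = ζ⁻¹ * (x (k₀ + l) - x' (k₀ + ((l + 1 : ℕ) : ℤ))) := by
          simp only [hx', e]
          have : ζ ≠ 0 := norm_pos_iff.1 hζ0
          field_simp
          ring
        have h4 : ‖x (k₀ + ((l + 1 : ℕ) : ℤ))‖
            ≤ ρ * (‖x (k₀ + l)‖ + ‖x' (k₀ + ((l + 1 : ℕ) : ℤ))‖) := by
          rw [h3, norm_mul, norm_inv]
          gcongr
          exact norm_sub_le _ _
        have h5 : K * (W + r ^ (l + 1) * ((1 + ‖ζ‖) * X))
            ≤ K * (1 + ‖ζ‖) * (W + r' ^ (l + 1) * X) := by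
          have : r ^ (l + 1) ≤ r' ^ (l + 1) := by gcongr
          have h6 : r ^ (l + 1) * ((1 + ‖ζ‖) * X) ≤ r' ^ (l + 1) * ((1 + ‖ζ‖) * X) := by gcongr
          have h7 : 0 ≤ ‖ζ‖ * W := by positivity
          calc _ ≤ K * ((1 + ‖ζ‖) * W + r' ^ (l + 1) * ((1 + ‖ζ‖) * X)) := by
                gcongr; nlinarith
            _ = _ := by ring
        calc ‖x (k₀ + ((l + 1 : ℕ) : ℤ))‖
            ≤ ρ * ((1 + M) * (W + r' ^ l * X) + M * (r' - ρ) * (W + r' ^ (l + 1) * X)) := by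
              rw [hMeq]
              exact h4.trans (by gcongr; exact h2.trans h5)
          _ ≤ (1 + M) * (W + r' ^ (l + 1) * X) := by
              have hp : 0 ≤ r' ^ l * X := mul_nonneg (pow_nonneg (by linarith) _) hX0
              have hr'0 : 0 < r' := by linarith
              rw [pow_succ, mul_right_comm]
              set p := r' ^ l * X
              have a1 : ρ * (1 + M) * W + ρ * (M * (r' - ρ)) * W ≤ (1 + M) * W := by
                have : ρ * (1 + M) + ρ * (M * (r' - ρ)) ≤ 1 + M := by
                  have : ρ * (M * (r' - ρ)) ≤ 1 * (M * (1 - ρ)) := by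
                    gcongr
                  nlinarith
                nlinarith
              have a2 : ρ * (1 + M) * p + ρ * (M * (r' - ρ)) * (p * r')
                  ≤ (1 + M) * (p * r') := by
                have : ρ * (M * (r' - ρ)) * (p * r') ≤ 1 * (M * (r' - ρ)) * (p * 1) := by
                  gcongr
                nlinarith
              nlinarith
    exact key n le_rfl

/-- Real form of `complex_filter_bound`, for `shiftApply`. -/
theorem stable_filter_bound (P : Polynomial ℝ) (h0 : P.coeff 0 = 1)
    (hP : ∀ z : ℂ, Polynomial.aeval z P = 0 → 1 < ‖z‖) :
    ∃ K r : ℝ, 0 ≤ K ∧ 0 < r ∧ r < 1 ∧ ∀ (x : ℤ → ℝ) (k₀ : ℤ) (n : ℕ) (W X : ℝ), 0 ≤ W →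
      (∀ j : ℕ, 1 ≤ j → j ≤ n → |shiftApply P x (k₀ + j)| ≤ W) →
      (∀ j : ℕ, j ≤ P.natDegree → |x (k₀ - j)| ≤ X) → |x (k₀ + n)| ≤ K * (W + r ^ n * X) := by
  have hne : P ≠ 0 := by rintro rfl; simp at h0
  obtain ⟨K, r, hK, hr, hr1, h⟩ := complex_filter_bound P.natDegree (P.map (algebraMap ℝ ℂ))
    (Polynomial.natDegree_map _)
    ((Polynomial.map_ne_zero_iff (algebraMap ℝ ℂ).injective).2 hne)
    (fun z hz => hP z (by
      rw [Polynomial.IsRoot.def, Polynomial.eval_map] at hz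
      rwa [Polynomial.aeval_def]))
  refine ⟨K, r, hK, hr, hr1, fun x k₀ n W X hW hw hx => ?_⟩
  have := h (fun l => (x l : ℂ)) k₀ n W X hW
    (fun j h1 h2 => by
      rw [ofReal_shiftApply, Complex.norm_real]; exact hw j h1 h2)
    (fun j hj => by rw [Complex.norm_real]; exact hx j hj)
  rwa [Complex.norm_real] at this

lemma exists_bound_Icc (x : ℤ → ℝ) (a b : ℤ) :
    ∃ X : ℝ, 0 ≤ X ∧ ∀ k, a ≤ k → k ≤ b → |x k| ≤ X := by
  refine ⟨∑ k ∈ Finset.Icc a b, |x k|, Finset.sum_nonneg fun _ _ => abs_nonneg _, ?_⟩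
  intro k h1 h2
  exact Finset.single_le_sum (f := fun k => |x k|) (fun _ _ => abs_nonneg _)
    (Finset.mem_Icc.2 ⟨h1, h2⟩)

/-- The `ℓ¹` norm of the coefficients of a polynomial. -/
noncomputable def coeffNorm (A : Polynomial ℝ) : ℝ :=
  ∑ s ∈ Finset.range (A.natDegree + 1), |A.coeff s|

lemma coeffNorm_nonneg (A : Polynomial ℝ) : 0 ≤ coeffNorm A :=
  Finset.sum_nonneg fun _ _ => abs_nonneg _

lemma abs_shiftApply_le (A : Polynomial ℝ) (x : ℤ → ℝ) (k : ℤ) {W : ℝ}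
    (h : ∀ s : ℕ, s ≤ A.natDegree → |x (k - s)| ≤ W) :
    |shiftApply A x k| ≤ coeffNorm A * W := by
  rw [shiftApply, coeffNorm, Finset.sum_mul]
  refine (Finset.abs_sum_le_sum_abs _ _).trans (Finset.sum_le_sum fun s hs => ?_)
  rw [abs_mul]
  have := h s (by simpa [Nat.lt_succ_iff] using hs)
  gcongr

lemma shiftApply_sub_const (A : Polynomial ℝ) (x : ℤ → ℝ) (c : ℝ) (k : ℤ) :
    shiftApply A (fun l => x l - c) k = shiftApply A x k - A.eval 1 * c := by
  simp only [shiftApply, Polynomial.eval_eq_sum_range, one_pow, mul_one, mul_sub,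
    Finset.sum_sub_distrib, Finset.sum_mul]

lemma eval_one_ne_zero_of_stable {P : Polynomial ℝ}
    (hP : ∀ z : ℂ, Polynomial.aeval z P = 0 → 1 < ‖z‖) : P.eval 1 ≠ 0 := by
  intro h
  have := hP 1 (by
    rw [← Polynomial.eval_map_algebraMap, show (1 : ℂ) = algebraMap ℝ ℂ 1 by simp,
      Polynomial.eval_map_apply, h, map_zero])
  simp at this

/-- The output of a stable filter grows at most as fast as its input. -/
theorem filter_growth {C D : Polynomial ℝ} (h0 : C.coeff 0 = 1)
    (hC : ∀ z : ℂ, Polynomial.aeval z C = 0 → 1 < ‖z‖) {x w : ℤ → ℝ}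
    (hxw : ∀ k : ℤ, 1 ≤ k → shiftApply C x (k + 1) = shiftApply D w k)
    {B θ : ℝ} (hθ : 0 ≤ θ) (hw : ∀ k : ℕ, 1 ≤ k → |w k| ≤ B * (k : ℝ) ^ θ) :
    ∃ B' : ℝ, 0 ≤ B' ∧ ∀ k : ℕ, 1 ≤ k → |x k| ≤ B' * (k : ℝ) ^ θ := by
  obtain ⟨K, r, hK, hr, hr1, h⟩ := stable_filter_bound C h0 hC
  have hB : 0 ≤ B := by simpa using (abs_nonneg _).trans (hw 1 le_rfl)
  set q := D.natDegree
  -- The filter estimate is started at time `q + 1`: from there on `D(z) w` involves `w` only at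
  -- times at least `1`, where its growth bound holds. The interval covers both the initial data
  -- needed there and the times `1, …, q + 1`.
  obtain ⟨X, hX0, hX⟩ := exists_bound_Icc x (min 1 ((q : ℤ) + 1 - C.natDegree)) (q + 1)
  have hD := coeffNorm_nonneg D
  refine ⟨X + K * (coeffNorm D * B + X), by positivity, fun k hk => ?_⟩
  have hk1 : (1 : ℝ) ≤ (k : ℝ) ^ θ := Real.one_le_rpow (by exact_mod_cast hk) hθ
  rcases le_or_gt k (q + 1) with hkq | hkq
  · have h1 := hX k (by omega) (by omega)
    have : 0 ≤ K * (coeffNorm D * B + X) := by positivity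
    nlinarith
  · obtain ⟨n, rfl⟩ : ∃ n, k = q + 1 + n := ⟨k - (q + 1), by omega⟩
    have h1 := h x (q + 1) n (coeffNorm D * (B * ((q + 1 + n : ℕ) : ℝ) ^ θ)) X (by positivity)
      (fun j hj1 hj2 => by
        have e := hxw ((q : ℤ) + j) (by omega)
        rw [show (q : ℤ) + 1 + j = q + j + 1 by ring, e]
        refine abs_shiftApply_le D w _ fun s hs => ?_
        obtain ⟨l, hl⟩ : ∃ l : ℕ, (q : ℤ) + j - s = l := ⟨q + j - s, by omega⟩
        rw [hl]
        refine (hw l (by omega)).trans ?_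
        gcongr
        omega)
      (fun j hj => hX _ (by omega) (by omega))
    have h2 : r ^ n * X ≤ X := mul_le_of_le_one_left hX0 (pow_le_one₀ hr.le hr1.le)
    push_cast at h1 hk1 ⊢
    set t := ((q : ℝ) + 1 + n) ^ θ
    have h3 : r ^ n * X ≤ X * t := by nlinarith
    have h4 : K * (coeffNorm D * (B * t) + r ^ n * X) ≤ K * (coeffNorm D * (B * t) + X * t) := by
      gcongr K * (_ + ?_)
    nlinarith

lemma tendsto_nat_sqrt : Tendsto Nat.sqrt atTop atTop :=
  tendsto_atTop_atTop.2 fun b => ⟨b * b, fun _ ha => Nat.le_sqrt.2 ha⟩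

/-- A stable filter tracks its steady state if its input is nearly constant for a long time. -/
theorem filter_tracking {C D : Polynomial ℝ} (h0 : C.coeff 0 = 1)
    (hC : ∀ z : ℂ, Polynomial.aeval z C = 0 → 1 < ‖z‖) {x w : ℤ → ℝ}
    (hxw : ∀ k : ℤ, 1 ≤ k → shiftApply C x (k + 1) = shiftApply D w k)
    {B θ : ℝ} (hθ0 : 0 ≤ θ) (hθ : θ ≤ 1 / 2) (hx : ∀ k : ℕ, 1 ≤ k → |x k| ≤ B * (k : ℝ) ^ θ) :
    ∃ K : ℝ, 0 ≤ K ∧ ∀ R η : ℝ, 0 < η → ∃ n₀ : ℕ, ∀ k : ℕ, n₀ ≤ k → ∀ wc δ : ℝ, 0 ≤ δ →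
      |wc| ≤ R → (∀ s : ℕ, k - Nat.sqrt k ≤ s → s ≤ k → |w s - wc| ≤ δ) →
      |x (k + 1) - D.eval 1 / C.eval 1 * wc| ≤ K * δ + η := by
  obtain ⟨K, r, hK, hr, hr1, h⟩ := stable_filter_bound C h0 hC
  have hB : 0 ≤ B := by simpa using (abs_nonneg _).trans (hx 1 le_rfl)
  have hC1 := eval_one_ne_zero_of_stable hC
  set q := D.natDegree
  set p := C.natDegree
  set g := D.eval 1 / C.eval 1
  have hD := coeffNorm_nonneg D
  refine ⟨K * coeffNorm D, by positivity, fun R η hη => ?_⟩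
  -- With `m = √k`, this is the influence of the past before the window: at the start of the window
  -- the signal is at most `B (m + 1)`, because `θ ≤ 1 / 2`, and the filter damps it by `r ^ (m -
  -- q)`.
  have hlim : Tendsto (fun m : ℕ => K * (r ^ (m - q) * (B * ((m : ℝ) + 1) + |g| * R)))
      atTop (𝓝 0) := by
    have t1 : Tendsto (fun m : ℕ => (m : ℝ) * r ^ m) atTop (𝓝 0) :=
      tendsto_self_mul_const_pow_of_lt_one hr.le hr1
    have t2 : Tendsto (fun m : ℕ => r ^ m) atTop (𝓝 0) :=
      tendsto_pow_atTop_nhds_zero_of_lt_one hr.le hr1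
    have t3 : Tendsto (fun m : ℕ => K * (r ^ m * (B * ((m + q : ℕ) + 1) + |g| * R)))
        atTop (𝓝 0) := by
      have := ((t1.const_mul B).add (t2.const_mul (B * (q + 1) + |g| * R))).const_mul K
      simp only [mul_zero, add_zero] at this
      refine this.congr fun m => ?_
      push_cast
      ring
    have t4 := t3.comp (tendsto_sub_atTop_nat q)
    refine t4.congr' ?_
    filter_upwards [eventually_ge_atTop q] with m hm
    simp only [Function.comp_apply]
    rw [show m - q + q = m by omega]
  have hev := (hlim.comp tendsto_nat_sqrt).eventually (gt_mem_nhds hη)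
  have hev2 := tendsto_nat_sqrt.eventually (eventually_ge_atTop (p + q + 2))
  obtain ⟨n₀, hn₀⟩ := eventually_atTop.1 (hev.and hev2)
  refine ⟨n₀, fun k hk wc δ hδ hwc hwin => ?_⟩
  obtain ⟨h1, h2⟩ := hn₀ k hk
  simp only [Function.comp_apply] at h1
  set m := Nat.sqrt k with hm
  have hmm : m * m ≤ k := Nat.sqrt_le k
  have hmk : m + m ≤ k := by nlinarith
  have hkm : (k : ℝ) ≤ ((m : ℝ) + 1) ^ 2 := by
    have : k ≤ (m + 1) ^ 2 := by rw [sq]; exact (Nat.lt_succ_sqrt k).le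
    exact_mod_cast this
  have hkθ : (k : ℝ) ^ θ ≤ m + 1 := by
    calc (k : ℝ) ^ θ ≤ (k : ℝ) ^ (1 / 2 : ℝ) :=
          Real.rpow_le_rpow_of_exponent_le (by exact_mod_cast (by omega : 1 ≤ k)) hθ
      _ = Real.sqrt k := by rw [Real.sqrt_eq_rpow]
      _ ≤ m + 1 := Real.sqrt_le_iff.2 ⟨by positivity, hkm⟩
  have hR : 0 ≤ R := (abs_nonneg _).trans hwc
  -- Since `C(1) g = D(1)`, the deviation from the steady state `g wc` obeys the same filter, driven
  -- by `w - wc`. Starting `q` steps inside the window keeps every delayed input within it.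
  have key := h (fun l => x l - g * wc) ((k - m + q : ℕ) : ℤ) (m + 1 - q) (coeffNorm D * δ)
    (B * ((m : ℝ) + 1) + |g| * R) (by positivity)
    (fun j hj1 hj2 => by
      have e := hxw (((k - m + q : ℕ) : ℤ) + j - 1) (by omega)
      have e2 : C.eval 1 * (g * wc) = D.eval 1 * wc := by
        simp only [g]; field_simp
      rw [shiftApply_sub_const, e2, ← sub_add_cancel (((k - m + q : ℕ) : ℤ) + j) 1, e,
        ← shiftApply_sub_const]
      refine abs_shiftApply_le D _ _ fun s hs => ?_
      obtain ⟨l, hl⟩ : ∃ l : ℕ, ((k - m + q : ℕ) : ℤ) + j - 1 - s = l :=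
        ⟨k - m + q + j - 1 - s, by omega⟩
      rw [hl]
      exact hwin l (by omega) (by omega))
    (fun j hj => by
      obtain ⟨l, hl⟩ : ∃ l : ℕ, ((k - m + q : ℕ) : ℤ) - j = l := ⟨k - m + q - j, by omega⟩
      rw [hl]
      calc |x l - g * wc| ≤ |x l| + |g * wc| := abs_sub _ _
        _ ≤ B * (k : ℝ) ^ θ + |g| * R := by
          rw [abs_mul]
          gcongr
          · refine (hx l (by omega)).trans ?_
            gcongr
            omega
        _ ≤ _ := by gcongr)
  have e3 : ((k - m + q : ℕ) : ℤ) + ((m + 1 - q : ℕ) : ℤ) = k + 1 := by omega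
  rw [e3] at key
  refine key.trans ?_
  have : r ^ (m + 1 - q) ≤ r ^ (m - q) := pow_le_pow_of_le_one hr.le hr1.le (by omega)
  have h5 : K * (r ^ (m + 1 - q) * (B * ((m : ℝ) + 1) + |g| * R))
      ≤ K * (r ^ (m - q) * (B * ((m : ℝ) + 1) + |g| * R)) := by gcongr
  linarith

/-! ### Growth and tracking for Hammerstein and Wiener agents -/

lemma exists_growth_bound {f : ℝ → ℝ} (hf : Continuous f) {ρ : ℝ}
    (h : f =O[cocompact ℝ] fun x : ℝ => |x| ^ ρ) :
    ∃ c : ℝ, 0 ≤ c ∧ ∀ x, |f x| ≤ c * (1 + |x| ^ ρ) := by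
  obtain ⟨c, hc⟩ := h.bound
  obtain ⟨s, hs, hsc⟩ := mem_cocompact.1 hc
  obtain ⟨b, hb⟩ := hs.exists_bound_of_continuousOn hf.continuousOn
  refine ⟨max (max b c) 0, le_max_right _ _, fun x => ?_⟩
  have hx : 0 ≤ |x| ^ ρ := by positivity
  by_cases hxs : x ∈ s
  · have h1 := hb x hxs
    rw [Real.norm_eq_abs] at h1
    have : b ≤ max (max b c) 0 := (le_max_left _ _).trans (le_max_left _ _)
    have h0 : 0 ≤ max (max b c) 0 := le_max_right _ _
    nlinarith
  · have h1 : ‖f x‖ ≤ c * ‖|x| ^ ρ‖ := hsc hxs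
    rw [Real.norm_eq_abs, Real.norm_eq_abs, abs_of_nonneg hx] at h1
    have : c ≤ max (max b c) 0 := (le_max_right _ _).trans (le_max_left _ _)
    have h0 : 0 ≤ max (max b c) 0 := le_max_right _ _
    nlinarith

/-- Composition with a function of polynomial growth keeps subpolynomial growth small. -/
lemma growth_comp {f : ℝ → ℝ} (hf : Continuous f) {ρ : ℝ} (hρ : 0 < ρ)
    (h : f =O[cocompact ℝ] fun x : ℝ => |x| ^ ρ) {x : ℤ → ℝ} {B θ : ℝ} (hB : 0 ≤ B)
    (hx : ∀ k : ℕ, 1 ≤ k → |x k| ≤ B * (k : ℝ) ^ (θ / ρ)) (hθ : 0 ≤ θ) :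
    ∃ B' : ℝ, 0 ≤ B' ∧ ∀ k : ℕ, 1 ≤ k → |f (x k)| ≤ B' * (k : ℝ) ^ θ := by
  obtain ⟨c, hc, hcf⟩ := exists_growth_bound hf h
  refine ⟨c * (1 + B ^ ρ), by positivity, fun k hk => ?_⟩
  have hk1 : (1 : ℝ) ≤ (k : ℝ) ^ θ := Real.one_le_rpow (by exact_mod_cast hk) hθ
  calc |f (x k)| ≤ c * (1 + |x k| ^ ρ) := hcf _
    _ ≤ c * (1 + (B * (k : ℝ) ^ (θ / ρ)) ^ ρ) := by gcongr; exact hx k hk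
    _ = c * (1 + B ^ ρ * (k : ℝ) ^ θ) := by
      rw [Real.mul_rpow hB (by positivity), ← Real.rpow_mul (by positivity),
        div_mul_cancel₀ _ hρ.ne']
    _ ≤ c * ((k : ℝ) ^ θ + B ^ ρ * (k : ℝ) ^ θ) := by gcongr
    _ = _ := by ring

section AgentLemmas

variable {A : Agent} {u v y : ℤ → ℝ}

/-- The signals produced by inputs of subpolynomial growth. -/
theorem Agent.Dynamics.growth (hA : A.Stable) (hf : Continuous A.f) {ρ : ℝ} (hρ : 0 < ρ)
    (hfρ : A.f =O[cocompact ℝ] fun x : ℝ => |x| ^ ρ) (hdyn : A.Dynamics u v y)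
    (hu : ∀ θ : ℝ, 0 < θ → ∃ B : ℝ, 0 ≤ B ∧ ∀ k : ℕ, 1 ≤ k → |u k| ≤ B * (k : ℝ) ^ θ) :
    (∃ B : ℝ, 0 ≤ B ∧ ∀ k : ℕ, 1 ≤ k → |y k| ≤ B * (k : ℝ) ^ (1 / 4 : ℝ)) ∧
    (∃ B : ℝ, 0 ≤ B ∧ ∀ k : ℕ, 1 ≤ k → |v k| ≤ B * (k : ℝ) ^ (1 / 4 : ℝ)) := by
  -- Any exponent in `(0, 1/2)` would serve: over `√k` steps of size `1/k`, increments bounded by `k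
  -- ^ (1/4)` still add up to `o(1)`. Inputs grow more slowly than every power, so the exponent `1 /
  -- 4 / ρ` is available before `f` is applied.
  have h4 : (0 : ℝ) ≤ 1 / 4 := by norm_num
  rcases A with ⟨_ | _, C, D, f, hC, hD⟩ <;> simp only [Agent.Dynamics] at hdyn
  · obtain ⟨B, hB, h⟩ := hu (1 / 4 / ρ) (by positivity)
    obtain ⟨B1, hB1, h1⟩ := growth_comp hf hρ hfρ hB h h4
    have hv : ∀ k : ℕ, 1 ≤ k → |v k| ≤ B1 * (k : ℝ) ^ (1 / 4 : ℝ) := fun k hk => by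
      rw [(hdyn k (by omega)).1]; exact h1 k hk
    exact ⟨filter_growth hC hA (fun k hk => (hdyn k hk).2) h4 hv, B1, hB1, hv⟩
  · constructor
    · obtain ⟨B, hB, h⟩ := hu (1 / 4 / ρ) (by positivity)
      obtain ⟨B1, hB1, h1⟩ := filter_growth hC hA (fun k hk => (hdyn k hk).1)
        (by positivity) h
      obtain ⟨B2, hB2, h2⟩ := growth_comp hf hρ hfρ hB1 h1 h4
      -- In the Wiener case `y 1` is initial data, not given by `f (v 1)`.
      refine ⟨B2 + |y 1|, by positivity, fun k hk => ?_⟩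
      have hk1 : (1 : ℝ) ≤ (k : ℝ) ^ (1 / 4 : ℝ) := Real.one_le_rpow (by exact_mod_cast hk) h4
      have hp := abs_nonneg (y 1)
      rcases Nat.eq_or_lt_of_le hk with rfl | hk'
      · simp only [Nat.cast_one, Real.one_rpow, mul_one]; linarith
      · have e := (hdyn ((k : ℤ) - 1) (by omega)).2
        rw [sub_add_cancel] at e
        rw [e]
        have := h2 k hk
        simp only at this
        nlinarith
    · obtain ⟨B, hB, h⟩ := hu (1 / 4) (by norm_num)
      exact filter_growth hC hA (fun k hk => (hdyn k hk).1) h4 h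

/-- If the input has been nearly constant for a long time, the output is close to the steady
state. -/
theorem Agent.Dynamics.tracking (hA : A.Stable) (hf : Continuous A.f)
    (hdyn : A.Dynamics u v y)
    (hy : ∃ B : ℝ, 0 ≤ B ∧ ∀ k : ℕ, 1 ≤ k → |y k| ≤ B * (k : ℝ) ^ (1 / 4 : ℝ))
    (hv : ∃ B : ℝ, 0 ≤ B ∧ ∀ k : ℕ, 1 ≤ k → |v k| ≤ B * (k : ℝ) ^ (1 / 4 : ℝ))
    (R : ℝ) {η : ℝ} (hη : 0 < η) :
    ∃ δ : ℝ, 0 < δ ∧ ∃ n₀ : ℕ, ∀ k : ℕ, n₀ ≤ k → |u k| ≤ R →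
      (∀ s : ℕ, k - Nat.sqrt k ≤ s → s ≤ k → |u s - u k| ≤ δ) →
      |y (k + 1) - A.h (u k)| ≤ η := by
  have huc : ∀ R' : ℝ, ∀ η' > 0, ∃ δ > 0, ∀ a b : ℝ, |a| ≤ R' → |b| ≤ R' → |a - b| < δ →
      |A.f a - A.f b| < η' := by
    intro R' η' hη'
    have := (isCompact_closedBall (0 : ℝ) R').uniformContinuousOn_of_continuous hf.continuousOn
    obtain ⟨δ, hδ, h⟩ := Metric.uniformContinuousOn_iff.1 this η' hη'
    refine ⟨δ, hδ, fun a b ha hb hab => h a ?_ b ?_ ?_⟩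
    · simpa using ha
    · simpa using hb
    · simpa [Real.dist_eq] using hab
  -- The window must start at time at least `1`, where `v = f(u)` is valid in the Hammerstein case.
  have hsmall : ∀ k : ℕ, 4 ≤ k → 1 ≤ k - Nat.sqrt k := fun k hk => by
    have : Nat.sqrt k < k := Nat.sqrt_lt_self (by omega)
    omega
  obtain ⟨By, hBy, hy⟩ := hy
  obtain ⟨Bv, hBv, hv⟩ := hv
  rcases A with ⟨_ | _, C, D, f, hC, hD⟩ <;> simp only [Agent.Dynamics] at hdyn
  · simp only [Agent.h]
    obtain ⟨K, hK, h⟩ :=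
      filter_tracking hC hA (fun k hk => (hdyn k hk).2) (by norm_num) (by norm_num) hy
    obtain ⟨b, hb⟩ := (isCompact_closedBall (0 : ℝ) R).exists_bound_of_continuousOn hf.continuousOn
    obtain ⟨n₀, hn₀⟩ := h b (η / 2) (by positivity)
    obtain ⟨δ, hδ, hfδ⟩ := huc (R + 1) (η / (2 * (K + 1))) (by positivity)
    refine ⟨min (δ / 2) 1, by positivity, max n₀ 4, fun k hk huk hwin => ?_⟩
    have hk1 : 1 ≤ k := by omega
    have := hn₀ k (by omega) (f (u k)) (η / (2 * (K + 1))) (by positivity)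
      (by simpa using hb (u k) (by simpa using huk))
      (fun s hs1 hs2 => by
        rw [(hdyn s (by have := hsmall k (by omega); omega)).1]
        have h1 := hwin s hs1 hs2
        have h2 := h1.trans (min_le_right _ _)
        refine (hfδ _ _ ?_ ?_ ?_).le
        · have := abs_sub_abs_le_abs_sub (u s) (u k)
          linarith
        · linarith
        · exact lt_of_le_of_lt (h1.trans (min_le_left _ _)) (by linarith))
    refine this.trans ?_
    have : K * (η / (2 * (K + 1))) ≤ η / 2 := by
      rw [mul_div_assoc', div_le_div_iff₀ (by positivity) (by norm_num)]
      nlinarith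
    linarith
  · simp only [Agent.h]
    set g := D.eval 1 / C.eval 1
    obtain ⟨K, hK, h⟩ :=
      filter_tracking hC hA (fun k hk => (hdyn k hk).1) (by norm_num) (by norm_num) hv
    obtain ⟨δ, hδ, hfδ⟩ := huc (|g| * R + 1) η hη
    set δ' := min (δ / 2) 1
    have hδ' : 0 < δ' := by positivity
    obtain ⟨n₀, hn₀⟩ := h R (δ' / 2) (by positivity)
    refine ⟨δ' / (2 * (K + 1)), by positivity, max n₀ 1, fun k hk huk hwin => ?_⟩
    rw [(hdyn k (by omega)).2]
    have h1 := hn₀ k (by omega) (u k) _ (by positivity) huk hwin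
    have h2 : K * (δ' / (2 * (K + 1))) ≤ δ' / 2 := by
      rw [mul_div_assoc', div_le_div_iff₀ (by positivity) (by norm_num)]
      nlinarith
    have h3 : |v (k + 1) - g * u k| ≤ δ' := by linarith
    have h4 : |g * u k| ≤ |g| * R := by rw [abs_mul]; gcongr
    refine (hfδ _ _ ?_ ?_ ?_).le
    · have := abs_sub_abs_le_abs_sub (v (k + 1)) (g * u k)
      have : δ' ≤ 1 := min_le_right _ _
      linarith
    · linarith
    · have : δ' ≤ δ / 2 := min_le_left _ _
      linarith

end AgentLemmas

/-! ### Convergence of the noise series -/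

section Noise

variable {Ω : Type*} [MeasurableSpace Ω] {μ : Measure Ω}

lemma eLpNorm_one_le_of_integral_sq_le [IsProbabilityMeasure μ] {X : Ω → ℝ} {B : ℝ}
    (hX : MemLp X 2 μ) (hB : ∫ ω, X ω ^ 2 ∂μ ≤ B) :
    eLpNorm X 1 μ ≤ ENNReal.ofReal (1 + B) := by
  have h2 : Integrable (fun ω => X ω ^ 2) μ := hX.integrable_sq
  have h1 : Integrable X μ := hX.integrable (by norm_num)
  rw [eLpNorm_one_eq_lintegral_enorm, ← ofReal_integral_norm_eq_lintegral_enorm h1]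
  refine ENNReal.ofReal_le_ofReal ?_
  calc ∫ ω, ‖X ω‖ ∂μ ≤ ∫ ω, (1 + X ω ^ 2) ∂μ := by
        refine integral_mono h1.norm (by fun_prop) fun ω => ?_
        simp only [Real.norm_eq_abs]
        have := sq_abs (X ω)
        nlinarith [sq_nonneg (|X ω| - 1)]
    _ = 1 + ∫ ω, X ω ^ 2 ∂μ := by rw [integral_add (by fun_prop) h2]; simp
    _ ≤ 1 + B := by linarith

/-- A series of independent centered random variables with summable variances converges almost
surely. -/
theorem ae_exists_tendsto_sum_of_indep [IsProbabilityMeasure μ] {X : ℕ → Ω → ℝ}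
    (hm : ∀ n, Measurable (X n)) (hind : iIndepFun X μ) (hL2 : ∀ n, MemLp (X n) 2 μ)
    (h0 : ∀ n, ∫ ω, X n ω ∂μ = 0) (hsum : Summable fun n => ∫ ω, X n ω ^ 2 ∂μ) :
    ∀ᵐ ω ∂μ, ∃ l, Tendsto (fun n => ∑ k ∈ Finset.range n, X k ω) atTop (𝓝 l) := by
  have hsm : ∀ n, StronglyMeasurable (X n) := fun n => (hm n).stronglyMeasurable
  set ℱ := Filtration.natural X hsm with hℱ
  have hint : ∀ n, Integrable (X n) μ := fun n => (hL2 n).integrable (by norm_num)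
  set S : ℕ → Ω → ℝ := fun n => ∑ k ∈ Finset.range (n + 1), X k with hS
  have hadp : StronglyAdapted ℱ S := fun n => by
    refine Finset.stronglyMeasurable_sum _ fun k hk => ?_
    exact (Filtration.stronglyAdapted_natural hsm k).mono (ℱ.mono (by
      have := Finset.mem_range.1 hk; omega))
  -- Independence and zero means make the partial sums a martingale; pairwise independence makes the
  -- variances add, which bounds it in `L²` and hence in `L¹`, so the martingale convergence theorem
  -- applies.
  have hmart : Martingale S ℱ μ := by
    refine martingale_of_condExp_sub_eq_zero_nat hadp
      (fun n => integrable_finsetSum' _ fun k _ => hint k) fun n => ?_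
    have e : S (n + 1) - S n = X (n + 1) := by
      simp only [hS]
      rw [Finset.sum_range_succ _ (n + 1)]
      simp
    rw [e]
    refine (hind.condExp_natural_ae_eq_of_lt hsm (Nat.lt_succ_self n)).trans ?_
    rw [h0]
    rfl
  have hSL2 : ∀ n, MemLp (S n) 2 μ := fun n => memLp_finsetSum' _ fun k _ => hL2 k
  have hvar : ∀ n, ∫ ω, S n ω ^ 2 ∂μ ≤ ∑' k, ∫ ω, X k ω ^ 2 ∂μ := by
    intro n
    have hS0 : ∫ ω, S n ω ∂μ = 0 := by
      simp only [hS, Finset.sum_apply]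
      rw [integral_finsetSum _ fun k _ => hint k]
      simp [h0]
    have e1 : Var[S n; μ] = ∫ ω, S n ω ^ 2 ∂μ :=
      variance_of_integral_eq_zero (hSL2 n).aestronglyMeasurable.aemeasurable hS0
    have e2 : Var[S n; μ] = ∑ k ∈ Finset.range (n + 1), Var[X k; μ] :=
      IndepFun.variance_sum (fun k _ => hL2 k) fun i _ j _ hij => hind.indepFun hij
    rw [← e1, e2]
    refine le_trans (le_of_eq ?_) (hsum.sum_le_tsum (Finset.range (n + 1))
      fun k _ => integral_nonneg fun ω => sq_nonneg _)
    exact Finset.sum_congr rfl fun k _ =>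
      variance_of_integral_eq_zero (hm k).aemeasurable (h0 k)
  have hbdd : ∀ n, eLpNorm (S n) 1 μ
      ≤ (Real.toNNReal (1 + ∑' k, ∫ ω, X k ω ^ 2 ∂μ) : ENNReal) := fun n =>
    eLpNorm_one_le_of_integral_sq_le (hSL2 n) (hvar n)
  filter_upwards [hmart.submartingale.exists_ae_tendsto_of_bdd hbdd] with ω ⟨l, hl⟩
  refine ⟨l, (tendsto_add_atTop_iff_nat 1).1 (hl.congr fun n => ?_)⟩
  simp [hS]

/-- The noise accumulated along an edge converges almost surely. -/
theorem ae_exists_tendsto_noise [IsProbabilityMeasure μ] {ε : ℕ → Ω → ℝ}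
    (hm : ∀ k : ℕ, 1 ≤ k → Measurable (ε k))
    (hind : iIndepFun (fun k : {k : ℕ // 1 ≤ k} => ε k.1) μ)
    (hmean : ∀ k : ℕ, 1 ≤ k → MemLp (ε k) 2 μ ∧ ∫ ω, ε k ω ∂μ = 0)
    {B : ℝ} (hvar : ∀ k : ℕ, 1 ≤ k → ∫ ω, |ε k ω| ^ 2 ∂μ ≤ B) :
    ∀ᵐ ω ∂μ, ∃ l, Tendsto (fun n => ∑ s ∈ Finset.range n, stepSize s * ε (s + 1) ω)
      atTop (𝓝 l) := by
  have hind' : iIndepFun (fun s : ℕ => ε (s + 1)) μ :=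
    hind.precomp (g := fun s : ℕ => (⟨s + 1, by omega⟩ : {k : ℕ // 1 ≤ k}))
      fun a b h => by simpa using h
  refine ae_exists_tendsto_sum_of_indep (X := fun s ω => stepSize s * ε (s + 1) ω)
    (fun s => (hm (s + 1) (by omega)).const_mul _) ?_
    (fun s => (hmean (s + 1) (by omega)).1.const_mul _)
    (fun s => by rw [integral_const_mul, (hmean (s + 1) (by omega)).2, mul_zero]) ?_
  · exact hind'.comp (fun s x => stepSize s * x) fun s => measurable_const_mul _
  -- The index `s = 0` is harmless: `stepSize 0 = 1 / 0 = 0`, and the majorant vanishes there too.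
  · refine Summable.of_nonneg_of_le (fun s => integral_nonneg fun ω => sq_nonneg _)
      (f := fun s : ℕ => B * (1 / (s : ℝ) ^ 2)) (fun s => ?_)
      ((Real.summable_one_div_nat_pow.2 (by norm_num)).mul_left B)
    have := hvar (s + 1) (by omega)
    simp only [sq_abs] at this
    simp only [mul_pow, integral_const_mul, stepSize, one_div, inv_pow]
    rw [mul_comm B]
    gcongr

end Noise

/-! ### The convex potential and consensus points -/

/-- The primitive of `h` vanishing at `0`. -/
noncomputable def primitive (h : ℝ → ℝ) (x : ℝ) : ℝ := ∫ t in (0 : ℝ)..x, h t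

lemma continuous_primitive {h : ℝ → ℝ} (hc : Continuous h) : Continuous (primitive h) :=
  intervalIntegral.continuous_primitive (fun _ _ => hc.intervalIntegrable _ _) 0

/-- Tangent line inequality: a primitive of a monotone function is convex. -/
lemma mul_sub_le_primitive_sub {h : ℝ → ℝ} (hc : Continuous h) (hm : Monotone h) (x y : ℝ) :
    h y * (x - y) ≤ primitive h x - primitive h y := by
  have e : primitive h x - primitive h y = ∫ t in y..x, h t :=
    intervalIntegral.integral_interval_sub_left (hc.intervalIntegrable _ _)
      (hc.intervalIntegrable _ _)
  rw [e]
  rcases le_total y x with hxy | hxy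
  · calc h y * (x - y) = ∫ _ in y..x, h y := by
          rw [intervalIntegral.integral_const, smul_eq_mul, mul_comm]
      _ ≤ _ := intervalIntegral.integral_mono_on hxy (by simp) (hc.intervalIntegrable _ _)
          fun t ht => hm ht.1
  · rw [intervalIntegral.integral_symm]
    have : ∫ t in x..y, h t ≤ ∫ _ in x..y, h y :=
      intervalIntegral.integral_mono_on hxy (hc.intervalIntegrable _ _) (by simp)
          fun t ht => hm ht.2
    rw [intervalIntegral.integral_const, smul_eq_mul] at this
    linarith

/-- Strictness comes from passing through the midpoint, where `h` already differs from `h y`. -/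
lemma mul_sub_lt_primitive_sub {h : ℝ → ℝ} (hc : Continuous h) (hm : StrictMono h) {x y : ℝ}
    (hxy : x ≠ y) : h y * (x - y) < primitive h x - primitive h y := by
  have h1 := mul_sub_le_primitive_sub hc hm.monotone x ((x + y) / 2)
  have h2 := mul_sub_le_primitive_sub hc hm.monotone ((x + y) / 2) y
  have h3 : h y * (x - y) < h ((x + y) / 2) * (x - (x + y) / 2) + h y * ((x + y) / 2 - y) := by
    rcases lt_or_gt_of_ne hxy with h | h
    · have := hm (by linarith : (x + y) / 2 < y)
      nlinarith
    · have := hm (by linarith : y < (x + y) / 2)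
      nlinarith
  linarith

/-- Coercivity: the tangents at points where `h = 1` and `h = -1` have slopes `1` and `-1` and lie
below the primitive. -/
lemma exists_abs_le_primitive_add {h : ℝ → ℝ} (hc : Continuous h) (hm : Monotone h)
    (hs : Function.Surjective h) : ∃ c : ℝ, ∀ x, |x| ≤ primitive h x + c := by
  obtain ⟨a, ha⟩ := hs 1
  obtain ⟨b, hb⟩ := hs (-1)
  refine ⟨max (a - primitive h a) (-b - primitive h b), fun x => ?_⟩
  have h1 := mul_sub_le_primitive_sub hc hm x a
  have h2 := mul_sub_le_primitive_sub hc hm x b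
  rw [ha] at h1
  rw [hb] at h2
  have h3 := le_max_left (a - primitive h a) (-b - primitive h b)
  have h4 := le_max_right (a - primitive h a) (-b - primitive h b)
  exact abs_le.2 ⟨by linarith, by linarith⟩

section Potential

variable {N : ℕ} {h : Fin N → ℝ → ℝ}

/-- The Lyapunov function `∑ᵢ ∫₀^{zᵢ} hᵢ`. -/
noncomputable def potential (h : Fin N → ℝ → ℝ) (z : Fin N → ℝ) : ℝ :=
  ∑ i, primitive (h i) (z i)

lemma continuous_potential (hc : ∀ i, Continuous (h i)) : Continuous (potential h) :=
  continuous_finsetSum _ fun i _ => (continuous_primitive (hc i)).comp (continuous_apply i)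

lemma sum_mul_sub_le_potential_sub (hc : ∀ i, Continuous (h i)) (hm : ∀ i, StrictMono (h i))
    (x y : Fin N → ℝ) : ∑ i, h i (y i) * (x i - y i) ≤ potential h x - potential h y := by
  rw [potential, potential, ← Finset.sum_sub_distrib]
  exact Finset.sum_le_sum fun i _ => mul_sub_le_primitive_sub (hc i) (hm i).monotone _ _

lemma sum_mul_sub_lt_potential_sub (hc : ∀ i, Continuous (h i)) (hm : ∀ i, StrictMono (h i))
    {x y : Fin N → ℝ} (hxy : x ≠ y) :
    ∑ i, h i (y i) * (x i - y i) < potential h x - potential h y := by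
  obtain ⟨i, hi⟩ := Function.ne_iff.1 hxy
  rw [potential, potential, ← Finset.sum_sub_distrib]
  exact Finset.sum_lt_sum (fun i _ => mul_sub_le_primitive_sub (hc i) (hm i).monotone _ _)
    ⟨i, Finset.mem_univ _, mul_sub_lt_primitive_sub (hc i) (hm i) hi⟩

lemma exists_norm_le_potential_add (hc : ∀ i, Continuous (h i)) (hm : ∀ i, StrictMono (h i))
    (hs : ∀ i, Function.Surjective (h i)) : ∃ c : ℝ, ∀ z, ‖z‖ ≤ potential h z + c := by
  choose c hcx using fun i => exists_abs_le_primitive_add (hc i) (hm i).monotone (hs i)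
  refine ⟨∑ i, c i, fun z => ?_⟩
  rw [potential, ← Finset.sum_add_distrib]
  refine (pi_norm_le_iff_of_nonneg (Finset.sum_nonneg fun i _ =>
    (abs_nonneg _).trans (hcx i (z i)))).2 fun i => ?_
  exact (hcx i (z i)).trans (Finset.single_le_sum
    (f := fun i => primitive (h i) (z i) + c i)
    (fun i _ => (abs_nonneg _).trans (hcx i (z i))) (Finset.mem_univ i))

/-- At a point with equal values of all `h i`, the potential is minimal on the hyperplane. -/
lemma potential_le_of_common_value (hc : ∀ i, Continuous (h i)) (hm : ∀ i, StrictMono (h i))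
    {z x : Fin N → ℝ} {c : ℝ} (hz : ∀ i, h i (z i) = c) :
    potential h z ≤ potential h x + c * (∑ i, z i - ∑ i, x i) := by
  have := sum_mul_sub_le_potential_sub hc hm x z
  simp only [hz, ← Finset.mul_sum, Finset.sum_sub_distrib] at this
  linarith

lemma potential_lt_of_common_value (hc : ∀ i, Continuous (h i)) (hm : ∀ i, StrictMono (h i))
    {z x : Fin N → ℝ} {c : ℝ} (hz : ∀ i, h i (z i) = c) (hzx : x ≠ z)
    (hsum : ∑ i, x i = ∑ i, z i) : potential h z < potential h x := by
  have := sum_mul_sub_lt_potential_sub hc hm hzx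
  simp only [hz, ← Finset.mul_sum, Finset.sum_sub_distrib, hsum, sub_self, mul_zero] at this
  linarith

/-- A larger common value would make every coordinate, hence the sum, strictly larger. So the common
values agree, and injectivity gives the points. -/
lemma common_value_unique [NeZero N] (hm : ∀ i, StrictMono (h i)) {z x : Fin N → ℝ} {c d : ℝ}
    (hz : ∀ i, h i (z i) = c) (hx : ∀ i, h i (x i) = d) (hsum : ∑ i, x i = ∑ i, z i) :
    x = z := by
  have key : ∀ {z x : Fin N → ℝ} {c d : ℝ}, (∀ i, h i (z i) = c) → (∀ i, h i (x i) = d) →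
      ∑ i, x i = ∑ i, z i → d ≤ c := by
    intro z x c d hz hx hsum
    by_contra! hlt
    have : ∀ i, z i < x i := fun i => (hm i).lt_iff_lt.1 (by rw [hz, hx]; exact hlt)
    have := Finset.sum_lt_sum_of_nonempty (s := Finset.univ)
      ⟨(0 : Fin N), Finset.mem_univ _⟩ fun i _ => this i
    linarith
  have : d = c := le_antisymm (key hz hx hsum) (key hx hz hsum.symm)
  ext i
  exact (hm i).injective (by rw [hz, hx, this])

/-- Every hyperplane `∑ᵢ zᵢ = s` contains a point where all `h i` are equal. -/
lemma exists_common_value [NeZero N] (hm : ∀ i, StrictMono (h i))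
    (hs : ∀ i, Function.Surjective (h i)) (s : ℝ) :
    ∃ (z : Fin N → ℝ) (c : ℝ), (∀ i, h i (z i) = c) ∧ ∑ i, z i = s := by
  set e : Fin N → (ℝ ≃o ℝ) := fun i => (hm i).orderIsoOfSurjective (h i) (hs i)
  -- Intermediate value theorem for the sum of the inverse functions, as a function of the common
  -- value `c`; the maximum and minimum of the `hᵢ (s / N)` bracket the target `s`.
  have hcont : Continuous fun c : ℝ => ∑ i, (e i).symm c :=
    continuous_finsetSum _ fun i _ => (e i).symm.continuous
  have hN : (Finset.univ : Finset (Fin N)).Nonempty := ⟨0, Finset.mem_univ _⟩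
  have hNpos : (0 : ℝ) < N := by exact_mod_cast Nat.pos_of_ne_zero (NeZero.ne N)
  obtain ⟨b, hb⟩ : ∃ b, s ≤ ∑ i, (e i).symm b := by
    refine ⟨Finset.univ.sup' hN fun i => e i (s / N), ?_⟩
    calc s = ∑ _i : Fin N, s / N := by simp; field_simp
      _ ≤ _ := Finset.sum_le_sum fun i _ => (e i).le_symm_apply.2
          (Finset.le_sup' (fun i => e i (s / N)) (Finset.mem_univ i))
  obtain ⟨a, ha⟩ : ∃ a, ∑ i, (e i).symm a ≤ s := by
    refine ⟨Finset.univ.inf' hN fun i => e i (s / N), ?_⟩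
    calc _ ≤ ∑ _i : Fin N, s / N := Finset.sum_le_sum fun i _ => (e i).symm_apply_le.2
          (Finset.inf'_le (fun i => e i (s / N)) (Finset.mem_univ i))
      _ = s := by simp; field_simp
  obtain ⟨c, hc⟩ := mem_range_of_exists_le_of_exists_ge hcont ⟨a, ha⟩ ⟨b, hb⟩
  exact ⟨fun i => (e i).symm c, c, fun i => (e i).apply_symm_apply c, hc⟩

end Potential

/-! ### The Laplacian flow and its dissipation -/

section Flow

variable {N : ℕ} (G : Network N)

/-- The consensus flow `-L y`. -/
noncomputable def flow (y : Fin N → ℝ) (i : Fin N) : ℝ :=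
  ∑ j ∈ G.nbrs i, G.P i j * (y j - y i)

lemma flow_eq_sum (y : Fin N → ℝ) (i : Fin N) : flow G y i = ∑ j, G.P i j * (y j - y i) := by
  refine Finset.sum_subset (Finset.subset_univ _) fun j _ hj => ?_
  rw [G.P_zero i j (by simpa [Network.nbrs] using hj), zero_mul]

lemma regression_eq_flow (A : Fin N → Agent) (w : Fin N → ℝ) (i : Fin N) :
    regression G A w i = flow G (fun j => (A j).h (w j)) i := by
  have e : ∑ j ∈ G.nbrs i, G.P i j = ∑ j, G.P i j :=
    Finset.sum_subset (Finset.subset_univ _) fun j _ hj =>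
      G.P_zero i j (by simpa [Network.nbrs] using hj)
  simp only [regression, Network.lap, Matrix.sub_mulVec, Pi.neg_apply, Pi.sub_apply,
    Matrix.mulVec_diagonal, flow_eq_sum, e, mul_sub, Finset.sum_sub_distrib, ← Finset.sum_mul]
  simp only [Matrix.mulVec, dotProduct]
  ring

/-- By symmetry of the weights, what `i` receives from `j` is what `j` loses to `i`. This
conservation law is what fixes the hyperplane. -/
lemma sum_flow (y : Fin N → ℝ) : ∑ i, flow G y i = 0 := by
  simp only [flow_eq_sum, mul_sub, Finset.sum_sub_distrib]
  rw [Finset.sum_comm, sub_eq_zero]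
  exact Finset.sum_congr rfl fun i _ => Finset.sum_congr rfl fun j _ => by rw [G.P_symm]

lemma continuous_flow : Continuous (flow G) := by
  unfold flow
  fun_prop

lemma sum_mul_flow (y : Fin N → ℝ) :
    ∑ i, y i * flow G y i = -(1 / 2 * ∑ i, ∑ j, G.P i j * (y j - y i) ^ 2) := by
  have e1 : ∑ i, y i * flow G y i = ∑ i, ∑ j, G.P i j * (y i * (y j - y i)) := by
    simp only [flow_eq_sum, Finset.mul_sum]
    exact Finset.sum_congr rfl fun i _ => Finset.sum_congr rfl fun j _ => by ring
  have e2 : ∑ i, y i * flow G y i = ∑ i, ∑ j, G.P i j * (y j * (y i - y j)) := by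
    rw [e1, Finset.sum_comm]
    exact Finset.sum_congr rfl fun i _ => Finset.sum_congr rfl fun j _ => by rw [G.P_symm]
  have e3 : ∑ i, y i * flow G y i + ∑ i, y i * flow G y i
      = -∑ i, ∑ j, G.P i j * (y j - y i) ^ 2 := by
    nth_rewrite 1 [e1]
    rw [e2, ← Finset.sum_add_distrib, ← Finset.sum_neg_distrib]
    refine Finset.sum_congr rfl fun i _ => ?_
    rw [← Finset.sum_add_distrib, ← Finset.sum_neg_distrib]
    exact Finset.sum_congr rfl fun j _ => by ring
  linarith

/-- The dissipation `yᵀ L y`. -/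
noncomputable def dissipation (y : Fin N → ℝ) : ℝ := -∑ i, y i * flow G y i

lemma Network.P_nonneg (i j : Fin N) : 0 ≤ G.P i j := by
  by_cases h : G.graph.Adj i j
  · exact (G.P_pos i j h).le
  · exact (G.P_zero i j h).ge

lemma dissipation_nonneg (y : Fin N → ℝ) : 0 ≤ dissipation G y := by
  rw [dissipation, sum_mul_flow, neg_neg]
  have : ∀ i j, 0 ≤ G.P i j * (y j - y i) ^ 2 := fun i j =>
    mul_nonneg (G.P_nonneg i j) (sq_nonneg _)
  have : 0 ≤ ∑ i, ∑ j, G.P i j * (y j - y i) ^ 2 :=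
    Finset.sum_nonneg fun i _ => Finset.sum_nonneg fun j _ => this i j
  linarith

lemma continuous_dissipation : Continuous (dissipation G) := by
  unfold dissipation flow
  fun_prop

/-- The dissipation is a sum of nonnegative edge terms, so each vanishes; equality across edges
propagates along walks. -/
lemma eq_of_dissipation_eq_zero (hG : G.graph.Connected) {y : Fin N → ℝ}
    (h : dissipation G y = 0) (i j : Fin N) : y i = y j := by
  rw [dissipation, sum_mul_flow, neg_neg] at h
  have h0 : ∀ i j, 0 ≤ G.P i j * (y j - y i) ^ 2 := fun i j =>
    mul_nonneg (G.P_nonneg i j) (sq_nonneg _)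
  have h1 : ∑ i, ∑ j, G.P i j * (y j - y i) ^ 2 = 0 := by linarith
  rw [Finset.sum_eq_zero_iff_of_nonneg fun i _ => Finset.sum_nonneg fun j _ => h0 i j] at h1
  have hadj : ∀ i j, G.graph.Adj i j → y i = y j := by
    intro i j hij
    have h2 := h1 i (Finset.mem_univ _)
    rw [Finset.sum_eq_zero_iff_of_nonneg fun j _ => h0 i j] at h2
    have h3 := h2 j (Finset.mem_univ _)
    have := (G.P_pos i j hij).ne'
    have h4 : y j - y i = 0 := by simpa [this] using h3
    linarith
  obtain ⟨p⟩ := hG.preconnected i j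
  induction p with
  | nil => rfl
  | cons hij _ ih => rw [hadj _ _ hij, ih]

lemma eq_of_flow_eq_zero (hG : G.graph.Connected) {y : Fin N → ℝ} (h : flow G y = 0)
    (i j : Fin N) : y i = y j :=
  eq_of_dissipation_eq_zero G hG (by simp [dissipation, h]) i j

end Flow

/-! ### Uniform dissipation on compact sets -/

section Compactness

variable {N : ℕ} {G : Network N} {h : Fin N → ℝ → ℝ}

lemma exists_pos_lower_bound {X : Type*} [TopologicalSpace X] {s : Set X} (hs : IsCompact s)
    {f : X → ℝ} (hf : Continuous f) (hpos : ∀ x ∈ s, 0 < f x) :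
    ∃ α : ℝ, 0 < α ∧ ∀ x ∈ s, α ≤ f x :=
  hs.exists_forall_le' hf.continuousOn hpos

lemma continuous_pi_map (hc : ∀ i, Continuous (h i)) :
    Continuous fun z : Fin N → ℝ => fun i => h i (z i) :=
  continuous_pi fun i => (hc i).comp (continuous_apply i)

/-- Away from the minimum of the potential over a hyperplane, there is dissipation. -/
lemma exists_dissipation_lower_bound_of_hyperplane (hG : G.graph.Connected)
    (hc : ∀ i, Continuous (h i)) (hm : ∀ i, StrictMono (h i)) {u : Fin N → ℝ} (R : ℝ)
    {η : ℝ} (hη : 0 < η) :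
    ∃ α : ℝ, 0 < α ∧ ∀ z : Fin N → ℝ, ‖z‖ ≤ R → ∑ i, z i = ∑ i, u i →
      potential h u + η ≤ potential h z → α ≤ dissipation G fun i => h i (z i) := by
  have hN := hG.nonempty
  have hV := continuous_potential hc
  obtain ⟨α, hα, h1⟩ := exists_pos_lower_bound
    (s := Metric.closedBall (0 : Fin N → ℝ) R ∩
      ({z | ∑ i, z i = ∑ i, u i} ∩ {z | potential h u + η ≤ potential h z}))
    ((isCompact_closedBall _ _).inter_right
      ((isClosed_eq (by fun_prop) (by fun_prop)).inter (isClosed_le (by fun_prop) hV)))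
    ((continuous_dissipation G).comp (continuous_pi_map hc)) (by
      rintro z ⟨_, hsum, hz⟩
      -- Without dissipation all `hᵢ (zᵢ)` agree, so `z` minimizes the potential on the hyperplane,
      -- contrary to `potential h u + η ≤ potential h z`.
      refine lt_of_le_of_ne (dissipation_nonneg G _) fun h0 => ?_
      have heq := eq_of_dissipation_eq_zero G hG h0.symm
      obtain ⟨i₀⟩ := hN
      have := potential_le_of_common_value hc hm (x := u) (fun i => heq i i₀)
      simp only [Set.mem_ofPred_eq] at hsum hz
      rw [hsum] at this
      linarith)
  exact ⟨α, hα, fun z h2 h3 h4 => h1 z ⟨by simpa using h2, h3, h4⟩⟩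

/-- Near a hyperplane, there is dissipation on the level sets of the potential which are above
its value at a given point of the hyperplane. -/
lemma exists_dissipation_lower_bound_near_hyperplane (hG : G.graph.Connected)
    (hc : ∀ i, Continuous (h i)) (hm : ∀ i, StrictMono (h i)) (u : Fin N → ℝ) (R : ℝ) :
    ∃ κ : ℝ, 0 < κ ∧ ∃ α : ℝ, 0 < α ∧ ∀ z : Fin N → ℝ, ‖z‖ ≤ R →
      |∑ i, z i - ∑ i, u i| ≤ κ →
      potential h u + 1 ≤ potential h z → α ≤ dissipation G fun i => h i (z i) := by
  have hN := hG.nonempty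
  have hV := continuous_potential hc
  have hH := continuous_pi_map hc
  obtain ⟨B, hB⟩ := (isCompact_closedBall (0 : Fin N → ℝ) R).exists_bound_of_continuousOn
    hH.continuousOn
  -- At a consensus point in the ball the common value is at most `|B|` in absolute value, so being
  -- off the hyperplane by `κ` raises the minimal potential by at most `|B| κ < 1`.
  set κ : ℝ := 1 / (2 * (|B| + 1)) with hκ
  have hκ0 : 0 < κ := by positivity
  have hBκ : |B| * κ < 1 := by
    rw [hκ, mul_one_div, div_lt_one (by positivity)]
    have := abs_nonneg B
    linarith
  obtain ⟨α, hα, h1⟩ := exists_pos_lower_bound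
    (s := Metric.closedBall (0 : Fin N → ℝ) R ∩
      ({z | |∑ i, z i - ∑ i, u i| ≤ κ} ∩ {z | potential h u + 1 ≤ potential h z}))
    ((isCompact_closedBall _ _).inter_right
      ((isClosed_le (by fun_prop) (by fun_prop)).inter (isClosed_le (by fun_prop) hV)))
    ((continuous_dissipation G).comp hH) (by
      rintro z ⟨hR, hsum, hz⟩
      refine lt_of_le_of_ne (dissipation_nonneg G _) fun h0 => ?_
      have heq := eq_of_dissipation_eq_zero G hG h0.symm
      obtain ⟨i₀⟩ := hN
      have h2 := potential_le_of_common_value hc hm (x := u) (fun i => heq i i₀)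
      have h3 : |h i₀ (z i₀)| ≤ |B| :=
        ((norm_le_pi_norm (fun i => h i (z i)) i₀).trans (hB z hR)).trans (le_abs_self B)
      simp only [Set.mem_ofPred_eq] at hsum hz
      have h4 : h i₀ (z i₀) * (∑ i, z i - ∑ i, u i) ≤ |B| * κ := by
        refine (le_abs_self _).trans ?_
        rw [abs_mul]
        gcongr
      linarith)
  exact ⟨κ, hκ0, α, hα, fun z h2 h3 h4 => h1 z ⟨by simpa using h2, h3, h4⟩⟩

/-- On a hyperplane, points with almost minimal potential are close to the minimum point. -/
lemma exists_potential_gap (hc : ∀ i, Continuous (h i)) (hm : ∀ i, StrictMono (h i))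
    {u : Fin N → ℝ} {c : ℝ} (hu : ∀ i, h i (u i) = c) (R : ℝ) {η : ℝ} (hη : 0 < η) :
    ∃ κ : ℝ, 0 < κ ∧ ∀ z : Fin N → ℝ, ‖z‖ ≤ R → ∑ i, z i = ∑ i, u i →
      potential h z < potential h u + κ → ‖z - u‖ < η := by
  have hV := continuous_potential hc
  obtain ⟨α, hα, h1⟩ := exists_pos_lower_bound
    (s := Metric.closedBall (0 : Fin N → ℝ) R ∩
      ({z | ∑ i, z i = ∑ i, u i} ∩ {z | η ≤ ‖z - u‖}))
    ((isCompact_closedBall _ _).inter_right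
      ((isClosed_eq (by fun_prop) (by fun_prop)).inter
        (isClosed_le (by fun_prop) (by fun_prop))))
    (f := fun z => potential h z - potential h u) (by fun_prop) (by
      rintro z ⟨_, hsum, hz⟩
      have : z ≠ u := by
        rintro rfl
        simp only [Set.mem_ofPred_eq, sub_self, norm_zero] at hz
        linarith
      have := potential_lt_of_common_value hc hm hu this hsum
      linarith)
  refine ⟨α, hα, fun z h2 h3 h4 => ?_⟩
  by_contra! h5
  have := h1 z ⟨by simpa using h2, h3, h5⟩
  linarith

end Compactness

/-! ### Truncation numbers and auxiliary inputs -/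

lemma bound_mono {cM : ℝ} (hcM : 0 < cM) {m n : ℕ} (h : m ≤ n) : bound cM m ≤ bound cM n := by
  have : (0 : ℝ) ≤ m := Nat.cast_nonneg m
  exact Real.log_le_log (by linarith) (by gcongr)

section Truncation

variable {N : ℕ} {G : Network N} {A : Fin N → Agent} {ustar : Fin N → ℝ} {cM : ℝ}
  {ε : Fin N → Fin N → ℕ → ℝ} {T : Trajectory N}

lemma sigma_le_sigmaBar (T : Trajectory N) (i : Fin N) (k : ℕ) : T.σ i k ≤ sigmaBar T k :=
  Finset.le_sup (f := fun i => T.σ i k) (Finset.mem_univ i)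

lemma sigma_le_sigmaPrime (i : Fin N) (k : ℕ) : T.σ i k ≤ sigmaPrime G T i k :=
  le_max_right _ _

lemma sigma_le_sigmaPrime_of_adj {i j : Fin N} (h : G.graph.Adj i j) (k : ℕ) :
    T.σ i k ≤ sigmaPrime G T j k :=
  le_max_of_le_left (Finset.le_sup (f := fun j => T.σ j k)
    (by simpa [Network.nbrs] using h.symm))

lemma sigmaPrime_le_sigmaBar (i : Fin N) (k : ℕ) : sigmaPrime G T i k ≤ sigmaBar T k :=
  max_le (Finset.sup_le fun j _ => sigma_le_sigmaBar T j k) (sigma_le_sigmaBar T i k)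

/-- All agents have reached the largest truncation number of the network. -/
def Informed (T : Trajectory N) (k : ℕ) : Prop := ∀ i, T.σ i k = sigmaBar T k

lemma Informed.uBar_eq {k : ℕ} (h : Informed T k) : uBar ustar T k = fun i => T.u i k := by
  ext i
  simp [uBar, h i]

/-- The largest distance between two nodes of the graph. -/
noncomputable def Network.diam (G : Network N) : ℕ :=
  Finset.univ.sup fun i => Finset.univ.sup fun j => G.graph.dist i j

lemma Network.dist_le_diam (G : Network N) (i j : Fin N) : G.graph.dist i j ≤ G.diam :=
  (Finset.le_sup (f := fun j => G.graph.dist i j) (Finset.mem_univ j)).trans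
    (Finset.le_sup (f := fun i => Finset.univ.sup fun j => G.graph.dist i j) (Finset.mem_univ i))

namespace ClosedLoop

variable (hT : ClosedLoop G A ustar cM ε T)
include hT

lemma sigma_succ (i : Fin N) {k : ℕ} (hk : 1 ≤ k) :
    (T.u i ((k + 1 : ℕ) : ℤ) = candidate G ustar ε T i k ∧ T.σ i (k + 1) = sigmaPrime G T i k ∧
      |candidate G ustar ε T i k| < bound cM (sigmaPrime G T i k)) ∨
    (T.u i ((k + 1 : ℕ) : ℤ) = ustar i ∧ T.σ i (k + 1) = sigmaPrime G T i k + 1 ∧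
      bound cM (sigmaPrime G T i k) ≤ |candidate G ustar ε T i k|) := by
  push_cast
  rcases lt_or_ge (|candidate G ustar ε T i k|) (bound cM (sigmaPrime G T i k)) with h | h
  · exact Or.inl ⟨(hT.keep i k hk h).1, (hT.keep i k hk h).2, h⟩
  · exact Or.inr ⟨(hT.truncate i k hk h).1, (hT.truncate i k hk h).2, h⟩

lemma sigmaPrime_le_sigma_succ (i : Fin N) {k : ℕ} (hk : 1 ≤ k) :
    sigmaPrime G T i k ≤ T.σ i (k + 1) := by
  rcases hT.sigma_succ i hk with h | h <;> omega

lemma sigmaBar_le_succ {k : ℕ} (hk : 1 ≤ k) : sigmaBar T k ≤ sigmaBar T (k + 1) :=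
  Finset.sup_le fun i _ => ((sigma_le_sigmaPrime (G := G) i k).trans
    (hT.sigmaPrime_le_sigma_succ i hk)).trans (sigma_le_sigmaBar T i _)

lemma sigmaBar_succ_le {k : ℕ} (hk : 1 ≤ k) : sigmaBar T (k + 1) ≤ sigmaBar T k + 1 := by
  refine Finset.sup_le fun i _ => ?_
  have := sigmaPrime_le_sigmaBar (G := G) (T := T) i k
  rcases hT.sigma_succ i hk with h | h <;> omega

lemma sigmaBar_one : sigmaBar T 1 = 0 :=
  le_antisymm (Finset.sup_le fun i _ => (hT.sigma_one i).le) (Nat.zero_le _)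

lemma sigmaBar_mono {k l : ℕ} (hk : 1 ≤ k) (hkl : k ≤ l) : sigmaBar T k ≤ sigmaBar T l := by
  induction l, hkl using Nat.le_induction with
  | base => exact le_rfl
  | succ l hl ih => exact ih.trans (hT.sigmaBar_le_succ (hk.trans hl))

/-- Used twice: the active bound at time `k` is at most logarithmic in `k`, and a high truncation
number can occur only at a late time. -/
lemma sigmaBar_lt {k : ℕ} (hk : 1 ≤ k) : sigmaBar T k < k := by
  induction k, hk using Nat.le_induction with
  | base => rw [hT.sigmaBar_one]; norm_num
  | succ l hl ih => have := hT.sigmaBar_succ_le hl; omega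

/-- The auxiliary inputs between two increases of the largest truncation number. -/
lemma uBar_succ {k : ℕ} (hk : 1 ≤ k) (h : sigmaBar T (k + 1) = sigmaBar T k) (i : Fin N) :
    uBar ustar T (k + 1) i = uBar ustar T k i +
      if sigmaPrime G T i k < sigmaBar T k then 0
      else stepSize k * innovation G ε T i (k + 1) := by
  have h1 := sigma_le_sigmaPrime (G := G) (T := T) i k
  have h2 := sigmaPrime_le_sigmaBar (G := G) (T := T) i k
  have h3 := sigma_le_sigmaBar T i (k + 1)
  simp only [uBar]
  by_cases hlt : sigmaPrime G T i k < sigmaBar T k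
  · rw [if_pos hlt, if_pos (show T.σ i k < sigmaBar T k by omega), add_zero]
    rcases hT.sigma_succ i hk with hs | hs
    · rw [if_pos (by omega)]
    · rw [hs.1, ite_self]
  · rw [if_neg hlt]
    rcases hT.sigma_succ i hk with hs | hs
    · rw [if_neg (by omega), hs.1, candidate, uPrime]
      congr 1
      by_cases he : sigmaPrime G T i k = T.σ i k
      · rw [if_pos he, if_neg (by omega)]
      · rw [if_neg he, if_pos (by omega)]
    · omega

/-- An agent attaining the new maximum was truncated in this very step, hence sits at `u^*`; the
others are assigned `u^*` by definition of `ū`. -/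
lemma uBar_succ_of_ne {k : ℕ} (hk : 1 ≤ k) (h : sigmaBar T (k + 1) ≠ sigmaBar T k) :
    uBar ustar T (k + 1) = ustar := by
  ext i
  have h2 := sigmaPrime_le_sigmaBar (G := G) (T := T) i k
  have h3 := hT.sigmaBar_le_succ hk
  rcases hT.sigma_succ i hk with hs | hs
  · rw [uBar, if_pos (by omega)]
  · rw [uBar, hs.1, ite_self]

/-- The largest truncation number does not change if no informed agent has to be truncated. -/
lemma sigmaBar_succ_eq {k : ℕ} (hk : 1 ≤ k)
    (h : ∀ i, |uBar ustar T k i + stepSize k * innovation G ε T i (k + 1)|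
      < bound cM (sigmaBar T k)) : sigmaBar T (k + 1) = sigmaBar T k := by
  refine le_antisymm (Finset.sup_le fun i _ => ?_) (hT.sigmaBar_le_succ hk)
  have h1 := sigma_le_sigmaPrime (G := G) (T := T) i k
  have h2 := sigmaPrime_le_sigmaBar (G := G) (T := T) i k
  rcases hT.sigma_succ i hk with hs | hs
  · omega
  · by_contra hcon
    -- Only a truncated agent that already knows the maximum can raise it, and for such an agent the
    -- tested value is the one built from `ū`.
    have he : sigmaPrime G T i k = sigmaBar T k := by omega
    have e : candidate G ustar ε T i k
        = uBar ustar T k i + stepSize k * innovation G ε T i (k + 1) := by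
      rw [candidate, uPrime, uBar]
      congr 1
      by_cases he : sigmaPrime G T i k = T.σ i k
      · rw [if_pos he, if_neg (by omega)]
      · rw [if_neg he, if_pos (by omega)]
    have := h i
    rw [← e, ← he] at this
    exact absurd hs.2.2 (not_le.2 this)

/-- Information about the last truncation spreads over the network within `diam` steps. -/
lemma informed_of_const (hG : G.graph.Connected) {k : ℕ} (hk : 1 ≤ k) {l : ℕ}
    (hl : k + G.diam ≤ l) (h : ∀ s, k ≤ s → s ≤ l → sigmaBar T s = sigmaBar T k) :
    Informed T l := by
  have hstay : ∀ i, ∀ s t, k ≤ s → s ≤ t → t ≤ l → T.σ i s = sigmaBar T k →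
      T.σ i t = sigmaBar T k := by
    intro i s t hs hst htl he
    induction t, hst using Nat.le_induction with
    | base => exact he
    | succ t ht ih =>
      have h1 := ih (by omega)
      have h2 := sigma_le_sigmaPrime (G := G) (T := T) i t
      have h3 := hT.sigmaPrime_le_sigma_succ i (show 1 ≤ t by omega)
      have h4 := sigma_le_sigmaBar T i (t + 1)
      have h5 := h (t + 1) (by omega) htl
      omega
  have hwalk : ∀ i j (p : G.graph.Walk i j) (s : ℕ), k ≤ s → s + p.length ≤ l →
      T.σ i s = sigmaBar T k → T.σ j (s + p.length) = sigmaBar T k := by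
    intro i j p
    induction p with
    | nil => intro s _ _ he; simpa using he
    | @cons a b c hab p ih =>
      intro s hs hsl he
      simp only [SimpleGraph.Walk.length_cons] at hsl ⊢
      have h1 : T.σ b (s + 1) = sigmaBar T k := by
        have h2 := sigma_le_sigmaPrime_of_adj (T := T) hab s
        have h3 := hT.sigmaPrime_le_sigma_succ b (show 1 ≤ s by omega)
        have h4 := sigma_le_sigmaBar T b (s + 1)
        have h5 := h (s + 1) (by omega) (by omega)
        omega
      have := ih (s + 1) (by omega) (by omega) h1
      rwa [show s + (p.length + 1) = s + 1 + p.length by ring]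
  have hN := hG.nonempty
  obtain ⟨i, -, hi⟩ := Finset.exists_mem_eq_sup Finset.univ Finset.univ_nonempty
    fun i => T.σ i k
  intro j
  obtain ⟨p, hp⟩ := hG.exists_walk_length_eq_dist i j
  have hd := G.dist_le_diam i j
  rw [h l (by omega) le_rfl]
  exact hstay j (k + p.length) l (by omega) (by omega) le_rfl
    (hwalk i j p k le_rfl (by omega) hi.symm)

lemma abs_u_succ_le (hcM : 0 < cM) (hustar : ∀ i, |ustar i| < bound cM 0) (i : Fin N) {k : ℕ}
    (hk : 1 ≤ k) : |T.u i ((k + 1 : ℕ) : ℤ)| < bound cM (sigmaBar T k) := by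
  rcases hT.sigma_succ i hk with hs | hs
  · rw [hs.1]
    exact lt_of_lt_of_le hs.2.2 (bound_mono hcM (sigmaPrime_le_sigmaBar i k))
  · rw [hs.1]
    exact lt_of_lt_of_le (hustar i) (bound_mono hcM (Nat.zero_le _))

/-- The inputs grow at most logarithmically, hence slower than any power. -/
lemma u_growth (hcM : 0 < cM) (hustar : ∀ i, |ustar i| < bound cM 0) (i : Fin N) {θ : ℝ}
    (hθ : 0 < θ) : ∃ B : ℝ, 0 ≤ B ∧ ∀ k : ℕ, 1 ≤ k → |T.u i k| ≤ B * (k : ℝ) ^ θ := by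
  have hlog : 0 ≤ Real.log (1 + cM) := Real.log_nonneg (by linarith)
  refine ⟨|T.u i 1| + (1 / θ + Real.log (1 + cM)), by positivity, fun k hk => ?_⟩
  have hk0 : (1 : ℝ) ≤ k := by exact_mod_cast hk
  have hk1 : (1 : ℝ) ≤ (k : ℝ) ^ θ := Real.one_le_rpow hk0 hθ.le
  have hB : 0 ≤ 1 / θ + Real.log (1 + cM) := by positivity
  have hu1 := abs_nonneg (T.u i 1)
  rcases Nat.eq_or_lt_of_le hk with rfl | hk'
  · simp only [Nat.cast_one, Real.one_rpow, mul_one]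
    linarith
  · obtain ⟨l, rfl⟩ : ∃ l, k = l + 1 := ⟨k - 1, by omega⟩
    have h1 := hT.abs_u_succ_le hcM hustar i (show 1 ≤ l by omega)
    have h2 : bound cM (sigmaBar T l) ≤ bound cM (l + 1) :=
      bound_mono hcM (by have := hT.sigmaBar_lt (show 1 ≤ l by omega); omega)
    have h3 : bound cM (l + 1) ≤ Real.log ((l + 1 : ℕ) : ℝ) + Real.log (1 + cM) := by
      rw [bound, ← Real.log_mul (by positivity) (by positivity)]
      refine Real.log_le_log (by positivity) ?_
      nlinarith
    have h4 := Real.log_le_rpow_div (x := ((l + 1 : ℕ) : ℝ)) (by positivity) hθ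
    set t := ((l + 1 : ℕ) : ℝ) ^ θ
    have h5 : t / θ = 1 / θ * t := by ring
    nlinarith

end ClosedLoop

end Truncation

/-! ### Slow variation and descent of the potential -/

lemma stepSize_nonneg (k : ℕ) : 0 ≤ stepSize k := by unfold stepSize; positivity

/-- Over about `√k` steps before time `k`, increments of size `k ^ (-3/4)` add up to a small
quantity. -/
lemma exists_movement_le (Q : ℝ) (hQ : 0 ≤ Q) (D : ℕ) {η : ℝ} (hη : 0 < η) :
    ∃ n₀ : ℕ, ∀ k, n₀ ≤ k → ∀ s, k ≤ s + Nat.sqrt k + D → s ≤ k →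
      ∑ r ∈ Finset.Ico s k, stepSize r * (Q * (r : ℝ) ^ (1 / 4 : ℝ)) ≤ η := by
  have hlim : Tendsto (fun k : ℕ => 4 * Q * (k : ℝ) ^ (-(1 / 4) : ℝ)) atTop (𝓝 0) := by
    have := ((tendsto_rpow_neg_atTop (show (0 : ℝ) < 1 / 4 by norm_num)).comp
      tendsto_natCast_atTop_atTop).const_mul (4 * Q)
    simpa using this
  obtain ⟨n₀, h⟩ := eventually_atTop.1 ((hlim.eventually (gt_mem_nhds hη)).and
    (tendsto_nat_sqrt.eventually (eventually_ge_atTop (D + 4))))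
  refine ⟨n₀, fun k hk s hs hsk => ?_⟩
  obtain ⟨h1, h2⟩ := h k hk
  set m := Nat.sqrt k with hm
  have hmm : m * m ≤ k := Nat.sqrt_le k
  have hm4 : 4 * m ≤ k := by nlinarith
  have hk0 : (0 : ℝ) < k := by exact_mod_cast (by omega : 0 < k)
  -- Since `√k ≥ D + 4`, the window has at most `2 √k ≤ k / 2` steps, so every `r` in it is at least
  -- `k / 2`.
  have hterm : ∀ r ∈ Finset.Ico s k, stepSize r * (Q * (r : ℝ) ^ (1 / 4 : ℝ))
      ≤ 2 / k * (Q * (k : ℝ) ^ (1 / 4 : ℝ)) := by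
    intro r hr
    obtain ⟨hr1, hr2⟩ := Finset.mem_Ico.1 hr
    have : (k : ℝ) ≤ 2 * r := by exact_mod_cast (by omega : k ≤ 2 * r)
    have hr0 : (0 : ℝ) < r := by linarith
    have h3 : stepSize r ≤ 2 / k := by
      rw [stepSize, div_le_div_iff₀ hr0 hk0]
      linarith
    gcongr
  have hmsqrt : (m : ℝ) ≤ (k : ℝ) ^ (1 / 2 : ℝ) := by
    rw [← Real.sqrt_eq_rpow]
    exact Real.nat_sqrt_le_real_sqrt
  have hcard : ((k - s : ℕ) : ℝ) ≤ 2 * (k : ℝ) ^ (1 / 2 : ℝ) := by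
    have : ((k - s : ℕ) : ℝ) ≤ 2 * (m : ℝ) := by exact_mod_cast (by omega : k - s ≤ 2 * m)
    linarith
  calc _ ≤ ∑ r ∈ Finset.Ico s k, 2 / k * (Q * (k : ℝ) ^ (1 / 4 : ℝ)) :=
        Finset.sum_le_sum hterm
    _ = ((k - s : ℕ) : ℝ) * (2 / k * (Q * (k : ℝ) ^ (1 / 4 : ℝ))) := by
        rw [Finset.sum_const, Nat.card_Ico, nsmul_eq_mul]
    _ ≤ 2 * (k : ℝ) ^ (1 / 2 : ℝ) * (2 / k * (Q * (k : ℝ) ^ (1 / 4 : ℝ))) := by gcongr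
    _ = 4 * Q * (k : ℝ) ^ (-(1 / 4) : ℝ) := by
        have e : (k : ℝ) ^ (-(1 / 4) : ℝ)
            = (k : ℝ) ^ (1 / 2 : ℝ) * (k : ℝ) ^ (1 / 4 : ℝ) / k := by
          rw [← Real.rpow_add hk0, ← Real.rpow_sub_one hk0.ne']
          norm_num
        rw [e]
        ring
    _ ≤ η := h1.le

/-- A real sequence which decreases along a divergent series of steps whenever it exceeds `c`
ends up near or below `c`. -/
lemma eventually_le_of_descent {x : ℕ → ℝ} {c η α : ℝ} (hα : 0 < α) {n₀ : ℕ}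
    (h1 : ∀ k, n₀ ≤ k → c ≤ x k → x (k + 1) ≤ x k - stepSize k * α)
    (h2 : ∀ k, n₀ ≤ k → x k < c → x (k + 1) ≤ c + η) : ∃ n₁, ∀ k, n₁ ≤ k → x k ≤ c + η := by
  -- Otherwise the divergent harmonic sum would push `x` below `c`. After one visit below `c`, the
  -- sequence rises only from below `c`, and then at most to `c + η`.
  have hex : ∃ k, n₀ ≤ k ∧ x k < c := by
    by_contra! hcon
    have hsum : ∀ n, x (n₀ + n) ≤ x n₀ - α * ∑ s ∈ Finset.range n, stepSize (n₀ + s) := by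
      intro n
      induction n with
      | zero => simp
      | succ n ih =>
        have := h1 (n₀ + n) (by omega) (hcon _ (by omega))
        rw [Finset.sum_range_succ, ← add_assoc]
        linarith
    have hdiv : Tendsto (fun n => ∑ s ∈ Finset.range n, stepSize (n₀ + s)) atTop atTop := by
      refine (not_summable_iff_tendsto_nat_atTop_of_nonneg fun s => stepSize_nonneg _).1 ?_
      intro hs
      refine Real.not_summable_one_div_natCast ((summable_nat_add_iff n₀).1 ?_)
      exact hs.congr fun s => by simp [stepSize, add_comm]
    obtain ⟨n, hn⟩ := (hdiv.eventually (eventually_gt_atTop ((x n₀ - c) / α))).exists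
    rw [div_lt_iff₀ hα] at hn
    have := hsum n
    have := hcon (n₀ + n) (by omega)
    linarith
  obtain ⟨k₁, hk₁, hx⟩ := hex
  refine ⟨k₁ + 1, fun k hk => ?_⟩
  induction k, hk using Nat.le_induction with
  | base => exact h2 k₁ hk₁ hx
  | succ k hk ih =>
    rcases lt_or_ge (x k) c with h | h
    · exact h2 k (by omega) h
    · have := h1 k (by omega) h
      have := mul_nonneg (stepSize_nonneg k) hα.le
      linarith

section Descent

variable {N : ℕ} {G : Network N} {h : Fin N → ℝ → ℝ} {u y : Fin N → ℕ → ℝ}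

/-- The output tracks the steady-state value of a slowly varying input. -/
def Tracks (h : ℝ → ℝ) (u y : ℕ → ℝ) : Prop :=
  ∀ R η : ℝ, 0 < η → ∃ δ : ℝ, 0 < δ ∧ ∃ n₀ : ℕ, ∀ k : ℕ, n₀ ≤ k → |u k| ≤ R →
    (∀ s : ℕ, k - Nat.sqrt k ≤ s → s ≤ k → |u s - u k| ≤ δ) → |y (k + 1) - h (u k)| ≤ η

lemma exists_uniform_tracking (htr : ∀ i, Tracks (h i) (u i) (y i)) (R : ℝ) {η : ℝ}
    (hη : 0 < η) : ∃ δ : ℝ, 0 < δ ∧ ∃ n₀ : ℕ, ∀ k : ℕ, n₀ ≤ k → ∀ i, |u i k| ≤ R →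
      (∀ s : ℕ, k - Nat.sqrt k ≤ s → s ≤ k → |u i s - u i k| ≤ δ) →
      |y i (k + 1) - h i (u i k)| ≤ η := by
  choose δ hδ n hn using fun i => htr i R η hη
  obtain ⟨d, hd⟩ := (eventually_all.2 fun i => Ioo_mem_nhdsGT (hδ i)).exists
  rcases isEmpty_or_nonempty (Fin N) with hN | ⟨⟨i₀⟩⟩
  · exact ⟨1, one_pos, 0, fun k _ i => hN.elim i⟩
  · refine ⟨d, (hd i₀).1, Finset.univ.sup n, fun k hk i hu hw => hn i k
      ((Finset.le_sup (Finset.mem_univ i)).trans hk) hu fun s h1 h2 =>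
        (hw s h1 h2).trans (hd i).2.le⟩

lemma exists_uniform_modulus {X Y : Type*} [PseudoMetricSpace X] [ProperSpace X]
    [PseudoMetricSpace Y] {f : X → Y} (hf : Continuous f) (x₀ : X) (R : ℝ) {η : ℝ}
    (hη : 0 < η) : ∃ δ : ℝ, 0 < δ ∧ ∀ a b, dist a x₀ ≤ R → dist a b ≤ δ → dist (f a) (f b) ≤ η := by
  have huc := (isCompact_closedBall x₀ (R + 1)).uniformContinuousOn_of_continuous hf.continuousOn
  obtain ⟨δ, hδ, h1⟩ := Metric.uniformContinuousOn_iff.1 huc η hη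
  refine ⟨min (δ / 2) 1, by positivity, fun a b ha hab => (h1 a ?_ b ?_ ?_).le⟩
  · exact Metric.mem_closedBall.2 (by linarith)
  · have := hab.trans (min_le_right _ _)
    have := dist_triangle_left b x₀ a
    exact Metric.mem_closedBall.2 (by linarith)
  · have := hab.trans (min_le_left _ _)
    linarith

lemma abs_sub_le_sum_of_steps {z : ℕ → ℝ} {b : ℕ → ℝ} {s k : ℕ} (hsk : s ≤ k)
    (h : ∀ r, s ≤ r → r < k → |z (r + 1) - z r| ≤ b r) :
    |z k - z s| ≤ ∑ r ∈ Finset.Ico s k, b r := by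
  induction k, hsk using Nat.le_induction with
  | base => simp
  | succ k hk ih =>
    rw [Finset.sum_Ico_succ_top hk]
    have h1 := ih fun r h1 h2 => h r h1 (by omega)
    have h2 := h k hk (Nat.lt_succ_self k)
    have := abs_sub_le (z (k + 1)) (z k) (z s)
    linarith

/-- The Lyapunov function decreases by (almost) the dissipation times the step size, if the plain
recursion has been valid and bounded for a long time. -/
theorem exists_descent (hc : ∀ i, Continuous (h i)) (hm : ∀ i, StrictMono (h i))
    (htr : ∀ i, Tracks (h i) (u i) (y i)) {E : ℕ → Fin N → ℝ} (hE : Tendsto E atTop (𝓝 0))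
    {Q : ℝ} (hQ0 : 0 ≤ Q)
    (hQ : ∀ k : ℕ, 1 ≤ k → ∀ i, |flow G (fun j => y j (k + 1)) i| ≤ Q * (k : ℝ) ^ (1 / 4 : ℝ))
    {R : ℝ} (hR : 0 ≤ R) {δ : ℝ} (hδ : 0 < δ) :
    ∃ n₀ : ℕ, ∀ k : ℕ, n₀ ≤ k → ∀ z : ℕ → Fin N → ℝ,
      (∀ s, k - Nat.sqrt k ≤ s → s ≤ k → ∀ i, z s i = u i s + E s i) →
      (∀ i, |u i k| ≤ R) →
      (∀ s, k - Nat.sqrt k ≤ s → s ≤ k → ∀ i,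
        z (s + 1) i = z s i + stepSize s * flow G (fun j => y j (s + 1)) i) →
      potential h (z (k + 1))
        ≤ potential h (z k) - stepSize k * (dissipation G (fun i => h i (z k i)) - δ) := by
  have hH := continuous_pi_map hc
  obtain ⟨B, hB⟩ := (isCompact_closedBall (0 : Fin N → ℝ) (R + 1)).exists_bound_of_continuousOn
    hH.continuousOn
  set F : (Fin N → ℝ) × (Fin N → ℝ) → ℝ := fun p => ∑ i, p.1 i * flow G p.2 i with hF
  have hFc : Continuous F := continuous_finsetSum _ fun i _ =>
    ((continuous_apply i).comp continuous_fst).mul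
      ((continuous_apply i).comp ((continuous_flow G).comp continuous_snd))
  obtain ⟨η₁, hη₁, hF1⟩ := exists_uniform_modulus hFc 0 B hδ
  obtain ⟨η₂, hη₂, hH2⟩ := exists_uniform_modulus hH 0 (R + 1) (half_pos hη₁)
  obtain ⟨δt, hδt, n₁, hn₁⟩ := exists_uniform_tracking htr R (half_pos hη₁)
  -- On the window `u = z - E` varies by at most the movement of `z` plus two noise tails, that is
  -- `3 θ < δt`. The bound `η₂` makes `h (z k)` close to both `h (z (k + 1))` and `h (u k)`, and `1`
  -- keeps `z k` in the ball of radius `R + 1`.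
  set θ := min (min (δt / 4) η₂) 1 with hθ
  have hθ0 : 0 < θ := by positivity
  have hθ1 : θ ≤ δt / 4 := (min_le_left _ _).trans (min_le_left _ _)
  have hθ2 : θ ≤ η₂ := (min_le_left _ _).trans (min_le_right _ _)
  have hθ3 : θ ≤ 1 := min_le_right _ _
  obtain ⟨n₂, hn₂⟩ := exists_movement_le Q hQ0 0 hθ0
  have hEev : ∀ᶠ k in atTop, ‖E k‖ < θ := by
    have := hE.norm
    rw [norm_zero] at this
    exact this.eventually (gt_mem_nhds hθ0)
  obtain ⟨n₃, hn₃⟩ := eventually_atTop.1 hEev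
  refine ⟨max (max n₁ n₂) (2 * n₃ + 4), fun k hk z hz hu hrec => ?_⟩
  set m := Nat.sqrt k with hm'
  have hmm : m * m ≤ k := Nat.sqrt_le k
  have hm2 : 2 ≤ m := Nat.le_sqrt.2 (by omega)
  have hmk : 2 * m ≤ k := by nlinarith
  have hEi : ∀ s, k - m ≤ s → ∀ i, |E s i| ≤ θ := fun s hs i =>
    (norm_le_pi_norm (E s) i).trans (hn₃ s (by omega)).le
  have hstep : ∀ s, k - m ≤ s → s ≤ k → ∀ i,
      |z (s + 1) i - z s i| ≤ stepSize s * (Q * (s : ℝ) ^ (1 / 4 : ℝ)) := by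
    intro s h1 h2 i
    rw [hrec s h1 h2 i, add_sub_cancel_left, abs_mul, abs_of_nonneg (stepSize_nonneg s)]
    exact mul_le_mul_of_nonneg_left (hQ s (by omega) i) (stepSize_nonneg s)
  have hmove : ∀ s, k - m ≤ s → s ≤ k → ∀ i, |z k i - z s i| ≤ θ := fun s h1 h2 i =>
    (abs_sub_le_sum_of_steps (z := fun s => z s i) h2
      fun r hr1 hr2 => hstep r (by omega) (by omega) i).trans (hn₂ k (by omega) s (by omega) h2)
  have hk1 : ∀ i, |z (k + 1) i - z k i| ≤ θ := by
    intro i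
    refine (hstep k (by omega) le_rfl i).trans ?_
    have := hn₂ (k + 1) (by omega) k (by
      have := Nat.le_sqrt.2 (show 1 * 1 ≤ k + 1 by omega)
      omega) (by omega)
    simpa using this
  have hyk : ∀ i, |y i (k + 1) - h i (u i k)| ≤ η₁ / 2 := by
    intro i
    refine hn₁ k (by omega) i (hu i) fun s hs1 hs2 => ?_
    have h1 := hmove s hs1 hs2 i
    rw [hz s hs1 hs2, hz k (by omega) le_rfl] at h1
    have h2 := abs_le.1 h1
    have h3 := abs_le.1 (hEi s hs1 i)
    have h4 := abs_le.1 (hEi k (by omega) i)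
    exact abs_le.2 ⟨by linarith, by linarith⟩
  have hzu : ∀ i, |z k i - u i k| ≤ θ := fun i => by
    rw [hz k (by omega) le_rfl, add_sub_cancel_left]
    exact hEi k (by omega) i
  set x : Fin N → ℝ := fun i => h i (z k i) with hx
  have hzR : ‖z k‖ ≤ R + 1 := by
    refine (pi_norm_le_iff_of_nonneg (by linarith)).2 fun i => ?_
    have h1 := abs_le.1 (hzu i)
    have h2 := abs_le.1 (hu i)
    exact abs_le.2 ⟨by linarith, by linarith⟩
  have hxB : ‖x‖ ≤ B := hB (z k) (by simpa using hzR)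
  have hx1 : dist x (fun i => h i (z (k + 1) i)) ≤ η₁ := by
    refine (hH2 (z k) (z (k + 1)) (by simpa using hzR) ?_).trans (by linarith)
    refine (dist_pi_le_iff hη₂.le).2 fun i => ?_
    rw [dist_comm, Real.dist_eq]
    exact (hk1 i).trans hθ2
  have hx2 : dist x (fun i => y i (k + 1)) ≤ η₁ := by
    have h1 : dist x (fun i => h i (u i k)) ≤ η₁ / 2 := by
      refine hH2 (z k) (fun i => u i k) (by simpa using hzR) ?_
      refine (dist_pi_le_iff hη₂.le).2 fun i => ?_
      rw [Real.dist_eq]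
      exact (hzu i).trans hθ2
    have h2 : dist (fun i => h i (u i k)) (fun i => y i (k + 1)) ≤ η₁ / 2 := by
      refine (dist_pi_le_iff (half_pos hη₁).le).2 fun i => ?_
      rw [dist_comm, Real.dist_eq]
      exact hyk i
    linarith [dist_triangle x (fun i => h i (u i k)) (fun i => y i (k + 1))]
  have hFF := hF1 (x, x) (fun i => h i (z (k + 1) i), fun i => y i (k + 1))
    (by rw [dist_zero_right]; simpa [Prod.norm_def] using hxB)
    (by rw [Prod.dist_eq]; exact max_le hx1 hx2)
  rw [dist_comm, Real.dist_eq] at hFF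
  have hFF' := (abs_le.1 hFF).2
  have hFx : F (x, x) = -dissipation G x := by simp [hF, dissipation]
  -- The tangent inequality is taken at the new point `z (k + 1)`, which bounds the increment of the
  -- potential with no second-order term; continuity of `h` then suffices to compare with the
  -- dissipation at `z k`.
  have hconv := sum_mul_sub_le_potential_sub hc hm (z k) (z (k + 1))
  have e : ∑ i, h i (z (k + 1) i) * (z k i - z (k + 1) i)
      = -(stepSize k * F (fun i => h i (z (k + 1) i), fun i => y i (k + 1))) := by
    rw [hF, Finset.mul_sum, ← Finset.sum_neg_distrib]
    refine Finset.sum_congr rfl fun i _ => ?_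
    have e0 : z k i - z (k + 1) i = -(stepSize k * flow G (fun j => y j (k + 1)) i) := by
      rw [hrec k (by omega) le_rfl i]
      ring
    rw [e0]
    ring
  rw [e] at hconv
  have := mul_le_mul_of_nonneg_left hFF' (stepSize_nonneg k)
  rw [hFx] at this
  linarith

end Descent

/-! ### Asymptotics of a single trajectory -/

section RegularPaths

variable {N : ℕ} {G : Network N} {A : Fin N → Agent} {ustar : Fin N → ℝ} {cM : ℝ}
  {ε : Fin N → Fin N → ℕ → ℝ} {T : Trajectory N} {E : ℕ → Fin N → ℝ} {Q : ℝ}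

/-- The properties of a single trajectory on which its asymptotic analysis rests; `E k` is the
tail from time `k` on of the accumulated noise. -/
structure RegularPath (G : Network N) (A : Fin N → Agent) (ε : Fin N → Fin N → ℕ → ℝ)
    (T : Trajectory N) (E : ℕ → Fin N → ℝ) (Q : ℝ) : Prop where
  h_cont : ∀ i, Continuous (A i).h
  h_mono : ∀ i, StrictMono (A i).h
  h_surj : ∀ i, Function.Surjective (A i).h
  tail_lim : Tendsto E atTop (𝓝 0)
  tail_succ : ∀ k i, E (k + 1) i = E k i -
    stepSize k * (innovation G ε T i (k + 1) - flow G (fun j => T.y j ((k + 1 : ℕ) : ℤ)) i)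
  Q_nonneg : 0 ≤ Q
  flow_le : ∀ k : ℕ, 1 ≤ k → ∀ i,
    |flow G (fun j => T.y j ((k + 1 : ℕ) : ℤ)) i| ≤ Q * (k : ℝ) ^ (1 / 4 : ℝ)
  tracks : ∀ i, Tracks (A i).h (fun k => T.u i k) fun k => T.y i k

/-- The auxiliary inputs, corrected by the remaining noise. -/
noncomputable def corrected (ustar : Fin N → ℝ) (T : Trajectory N) (E : ℕ → Fin N → ℝ) (k : ℕ)
    (i : Fin N) : ℝ := uBar ustar T k i + E k i

namespace RegularPath

variable (hP : RegularPath G A ε T E Q) (hT : ClosedLoop G A ustar cM ε T)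
include hP hT

/-- The decrement of the noise tail cancels the noise in the innovation, leaving the pure flow. For
an agent not yet aware of the maximum, `ū` rests and only the tail changes. -/
lemma corrected_succ {k : ℕ} (hk : 1 ≤ k) (h : sigmaBar T (k + 1) = sigmaBar T k) (i : Fin N) :
    corrected ustar T E (k + 1) i = corrected ustar T E k i +
      if sigmaPrime G T i k < sigmaBar T k then E (k + 1) i - E k i
      else stepSize k * flow G (fun j => T.y j ((k + 1 : ℕ) : ℤ)) i := by
  have h1 := hT.uBar_succ hk h i
  rw [corrected, corrected, h1]
  split_ifs
  · ring
  · rw [hP.tail_succ]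
    ring

lemma corrected_succ_of_informed {k : ℕ} (hk : 1 ≤ k) (hi : Informed T k)
    (h : sigmaBar T (k + 1) = sigmaBar T k) (i : Fin N) :
    corrected ustar T E (k + 1) i = corrected ustar T E k i +
      stepSize k * flow G (fun j => T.y j ((k + 1 : ℕ) : ℤ)) i := by
  rw [hP.corrected_succ hT hk h i, if_neg]
  have h2 := sigma_le_sigmaPrime (G := G) (T := T) i k
  have := hi i
  omega

lemma sum_corrected_succ {k : ℕ} (hk : 1 ≤ k) (hi : Informed T k)
    (h : sigmaBar T (k + 1) = sigmaBar T k) :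
    ∑ i, corrected ustar T E (k + 1) i = ∑ i, corrected ustar T E k i := by
  simp only [hP.corrected_succ_of_informed hT hk hi h, Finset.sum_add_distrib,
    ← Finset.mul_sum, sum_flow, mul_zero, add_zero]

/-- After a truncation, the corrected auxiliary inputs move slowly away from `u^*`. -/
lemma exists_abs_corrected_sub_le {τ : ℕ} (hτ : 1 ≤ τ) (hu : uBar ustar T τ = ustar) (i : Fin N)
    {k : ℕ} (hk : τ ≤ k) (h : ∀ s, τ ≤ s → s ≤ k → sigmaBar T s = sigmaBar T τ) :
    ∃ s, τ ≤ s ∧ s ≤ k ∧ |corrected ustar T E k i - ustar i - E s i|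
      ≤ ∑ r ∈ Finset.Ico τ k, stepSize r * (Q * (r : ℝ) ^ (1 / 4 : ℝ)) := by
  induction k, hk using Nat.le_induction with
  | base => exact ⟨τ, le_rfl, le_rfl, by simp [corrected, hu]⟩
  | succ k hk ih =>
    obtain ⟨s, hs1, hs2, hs⟩ := ih fun s h1 h2 => h s h1 (by omega)
    have he : sigmaBar T (k + 1) = sigmaBar T k := by
      rw [h (k + 1) (by omega) le_rfl, h k hk (by omega)]
    have hnn : 0 ≤ ∑ r ∈ Finset.Ico τ k, stepSize r * (Q * (r : ℝ) ^ (1 / 4 : ℝ)) :=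
      (abs_nonneg _).trans hs
    have hQ := hP.Q_nonneg
    have hnn' : 0 ≤ stepSize k * (Q * (k : ℝ) ^ (1 / 4 : ℝ)) :=
      mul_nonneg (stepSize_nonneg k) (by positivity)
    have h1 := hP.corrected_succ hT (by omega) he i
    rw [Finset.sum_Ico_succ_top hk]
    split_ifs at h1 with hlt
    · refine ⟨k + 1, by omega, le_rfl, ?_⟩
      -- While the agent is unaware, `ū` equals `u^*`, so the deviation is just the current tail and
      -- the witness `s` advances to `k + 1`. Once it is aware, `s` is frozen and flow increments
      -- accumulate.
      have h2 : uBar ustar T k i = ustar i := by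
        rw [uBar, if_pos ((sigma_le_sigmaPrime (G := G) i k).trans_lt hlt)]
      have e : corrected ustar T E (k + 1) i - ustar i - E (k + 1) i = 0 := by
        rw [h1, corrected, h2]
        ring
      rw [e, abs_zero]
      linarith
    · refine ⟨s, hs1, by omega, ?_⟩
      rw [h1]
      have h3 : |stepSize k * flow G (fun j => T.y j ((k + 1 : ℕ) : ℤ)) i|
          ≤ stepSize k * (Q * (k : ℝ) ^ (1 / 4 : ℝ)) := by
        rw [abs_mul, abs_of_nonneg (stepSize_nonneg k)]
        exact mul_le_mul_of_nonneg_left (hP.flow_le k (by omega) i) (stepSize_nonneg k)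
      refine le_trans ?_ (add_le_add hs h3)
      refine le_trans (le_of_eq ?_) (abs_add_le _ _)
      congr 1
      ring

omit hT in
lemma exists_step_le {η : ℝ} (hη : 0 < η) :
    ∃ n₀ : ℕ, 1 ≤ n₀ ∧ ∀ k : ℕ, n₀ ≤ k →
      stepSize k * (Q * (k : ℝ) ^ (1 / 4 : ℝ)) ≤ η ∧ ∀ i, |E k i| ≤ η := by
  obtain ⟨n₁, h1⟩ := exists_movement_le Q hP.Q_nonneg 1 hη
  have hE := hP.tail_lim.norm
  rw [norm_zero] at hE
  obtain ⟨n₂, h2⟩ := eventually_atTop.1 (hE.eventually (gt_mem_nhds hη))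
  refine ⟨max n₁ n₂ + 1, by omega, fun k hk => ⟨?_, fun i =>
    (norm_le_pi_norm (E k) i).trans (h2 k (by omega)).le⟩⟩
  simpa using h1 (k + 1) (by omega) k (by omega) (by omega)

/-- Descent of the Lyapunov function along the corrected auxiliary inputs. -/
lemma exists_corrected_descent {R : ℝ} (hR : 0 ≤ R) {δ : ℝ} (hδ : 0 < δ) :
    ∃ n₀ : ℕ, ∀ k : ℕ, n₀ ≤ k → (∀ s, k - Nat.sqrt k ≤ s → s ≤ k → Informed T s) →
      (∀ s, k - Nat.sqrt k ≤ s → s ≤ k → sigmaBar T (s + 1) = sigmaBar T s) →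
      (∀ i, |uBar ustar T k i| ≤ R) →
      potential (fun i => (A i).h) (corrected ustar T E (k + 1))
        ≤ potential (fun i => (A i).h) (corrected ustar T E k) - stepSize k *
          (dissipation G (fun i => (A i).h (corrected ustar T E k i)) - δ) := by
  obtain ⟨n₀, h⟩ := exists_descent (G := G) hP.h_cont hP.h_mono hP.tracks hP.tail_lim
    hP.Q_nonneg hP.flow_le hR hδ
  refine ⟨max n₀ 4, fun k hk hinf hconst hbd => ?_⟩
  have hk' : Nat.sqrt k < k := Nat.sqrt_lt_self (by omega)
  refine h k (by omega) _ (fun s h1 h2 i => ?_) (fun i => ?_) fun s h1 h2 i => ?_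
  · rw [corrected, (hinf s h1 h2).uBar_eq]
  · have := hbd i
    rwa [(hinf k (by omega) le_rfl).uBar_eq] at this
  · exact hP.corrected_succ_of_informed hT (by omega) (hinf s h1 h2) (hconst s h1 h2) i

end RegularPath

lemma exists_lt_bound (R cM : ℝ) : ∃ m : ℕ, ∀ n, m ≤ n → R < bound cM n :=
  eventually_atTop.1 ((Real.tendsto_log_atTop.comp (tendsto_atTop_add_const_right _ cM
    tendsto_natCast_atTop_atTop)).eventually (eventually_gt_atTop R))

/-- The truncation numbers stay bounded. -/
theorem RegularPath.exists_sigmaBar_le (hP : RegularPath G A ε T E Q)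
    (hT : ClosedLoop G A ustar cM ε T) (hG : G.graph.Connected) :
    ∃ m, ∀ k, 1 ≤ k → sigmaBar T k ≤ m := by
  by_contra! hunb
  have hN := hG.nonempty
  set h : Fin N → ℝ → ℝ := fun i => (A i).h with hh
  have hVc := continuous_potential hP.h_cont
  set V := potential h with hV
  set z := corrected ustar T E with hz
  obtain ⟨c, hc⟩ := exists_norm_le_potential_add hP.h_cont hP.h_mono hP.h_surj
  set R := max (V ustar + 2 + c) 0 with hR
  -- `R` bounds the sublevel set `V ≤ V(u^*) + 2`, within which the trajectory is to be trapped.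
  have hR0 : 0 ≤ R := le_max_right _ _
  have hVR : ∀ x, V x ≤ V ustar + 2 → ‖x‖ ≤ R := fun x hx =>
    (hc x).trans (le_trans (by linarith) (le_max_left _ _))
  obtain ⟨κ, hκ, α, hα, hdiss⟩ := exists_dissipation_lower_bound_near_hyperplane hG hP.h_cont
    hP.h_mono ustar R
  obtain ⟨η₁, hη₁, hmod⟩ := exists_uniform_modulus hVc 0 (max R ‖ustar‖) (half_pos one_pos)
  have hNpos : (0 : ℝ) < N := by
    have : 0 < N := Fin.pos_iff_nonempty.2 hN
    exact_mod_cast this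
  -- The part `η₁ / 4` lets moves of size `2 η` change `V` by at most `1/2`; `κ / N / 2` makes `N`
  -- such moves change the sum by at most `κ`; `1 / 4` keeps the value tested for truncation below
  -- `R + 2`.
  set η := min (min (η₁ / 4) (κ / N / 2)) (1 / 4) with hη
  have hη0 : 0 < η := by positivity
  have hηη₁ : η ≤ η₁ / 4 := (min_le_left _ _).trans (min_le_left _ _)
  have hηκ : η ≤ κ / N / 2 := (min_le_left _ _).trans (min_le_right _ _)
  have hη1 : η ≤ 1 / 4 := min_le_right _ _
  obtain ⟨n₁, hn₁⟩ := hP.exists_corrected_descent hT (show 0 ≤ R + 1 by linarith) hα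
  obtain ⟨n₂, hn₂⟩ := exists_movement_le Q hP.Q_nonneg G.diam hη0
  obtain ⟨n₃, hn₃1, hn₃⟩ := hP.exists_step_le hη0
  obtain ⟨n₄, hn₄⟩ := exists_lt_bound (R + 2) cM
  set m := n₁ + n₂ + n₃ + n₄ with hm
  obtain ⟨k₀, hk₀1, hk₀⟩ := hunb m
  have hex : ∃ k, 1 ≤ k ∧ m ≤ sigmaBar T k := ⟨k₀, hk₀1, hk₀.le⟩
  classical
  set τ := Nat.find hex with hτ
  obtain ⟨hτ1, hτm⟩ : 1 ≤ τ ∧ m ≤ sigmaBar T τ := Nat.find_spec hex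
  -- Hence `τ > m`, and `m` exceeds every threshold `n₁, …, n₄`: all asymptotic estimates are
  -- already valid at time `τ`.
  have hτlt := hT.sigmaBar_lt hτ1
  obtain ⟨t, ht⟩ : ∃ t, τ = t + 1 := ⟨τ - 1, by omega⟩
  have ht1 : 1 ≤ t := by
    rcases Nat.eq_zero_or_pos t with h0 | h0
    · rw [h0] at ht
      rw [ht, hT.sigmaBar_one] at hτm
      omega
    · exact h0
  have htm : sigmaBar T t < m := by
    by_contra! hcon
    have : τ ≤ t := Nat.find_min' hex ⟨ht1, hcon⟩
    omega
  have hτeq : sigmaBar T τ = m := by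
    have := hT.sigmaBar_succ_le ht1
    rw [← ht] at this
    omega
  have hτu : uBar ustar T τ = ustar := by
    rw [ht]
    exact hT.uBar_succ_of_ne ht1 (by rw [← ht]; omega)
  have hstart : ∀ k, τ ≤ k → (∀ s, τ ≤ s → s ≤ k → sigmaBar T s = m) →
      k ≤ τ + Nat.sqrt k + G.diam → ∀ i, |z k i - ustar i| ≤ 2 * η := by
    intro k hk hconst hkτ i
    obtain ⟨s, hs1, hs2, hs⟩ := hP.exists_abs_corrected_sub_le hT hτ1 hτu i hk
      fun s h1 h2 => by rw [hconst s h1 h2, hτeq]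
    have h1 := abs_le.1 (hs.trans (hn₂ k (by omega) τ hkτ hk))
    have h2 := abs_le.1 ((hn₃ s (by omega)).2 i)
    exact abs_le.2 ⟨by linarith, by linarith⟩
  have hinf : ∀ k, τ + G.diam ≤ k → (∀ s, τ ≤ s → s ≤ k → sigmaBar T s = m) → Informed T k :=
    fun k hk hconst => hT.informed_of_const hG hτ1 hk fun s h1 h2 => by
      rw [hconst s h1 h2, hτeq]
  -- The sum need not be conserved while some agents are uninformed, but `z` is still near `u^*` at
  -- time `τ + diam`; from then on it is exactly conserved.
  have hsum : ∀ k, τ + G.diam ≤ k → (∀ s, τ ≤ s → s ≤ k → sigmaBar T s = m) →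
      |∑ i, z k i - ∑ i, ustar i| ≤ κ := by
    intro k hk
    induction k, hk using Nat.le_induction with
    | base =>
      intro hconst
      have h1 := hstart (τ + G.diam) (by omega) hconst (by omega)
      rw [← Finset.sum_sub_distrib]
      calc _ ≤ ∑ i, |z (τ + G.diam) i - ustar i| := Finset.abs_sum_le_sum_abs _ _
        _ ≤ ∑ _i : Fin N, κ / N := Finset.sum_le_sum fun i _ => (h1 i).trans (by linarith)
        _ = κ := by simp; field_simp
    | succ k hk ih =>
      intro hconst
      have hconst' : ∀ s, τ ≤ s → s ≤ k → sigmaBar T s = m := fun s h1 h2 =>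
        hconst s h1 (by omega)
      have h1 := hP.sum_corrected_succ hT (by omega) (hinf k hk hconst')
        (by rw [hconst (k + 1) (by omega) le_rfl, hconst k (by omega) (by omega)])
      rw [hz, h1]
      exact ih hconst'
  -- The two claims support each other: the bound on `V` prevents a truncation in the next step, and
  -- without truncation the recursion for `z` controls `V`. Below `V(u^*) + 1` a single step raises
  -- `V` by at most `1/2`; above it `V` does not increase.
  have hmain : ∀ k, τ ≤ k → (∀ s, τ ≤ s → s ≤ k → sigmaBar T s = m) ∧ V (z k) ≤ V ustar + 2 := by
    intro k hk
    induction k, hk using Nat.le_induction with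
    | base =>
      have hc0 : ∀ s, τ ≤ s → s ≤ τ → sigmaBar T s = m := fun s h1 h2 => by
        rw [show s = τ by omega, hτeq]
      refine ⟨hc0, ?_⟩
      have h1 := hstart τ le_rfl hc0 (by omega)
      have h2 := hmod ustar (z τ) (by simp) ((dist_pi_le_iff hη₁.le).2 fun i => by
        rw [dist_comm, Real.dist_eq]; exact (h1 i).trans (by linarith))
      rw [dist_comm, Real.dist_eq] at h2
      have := (abs_le.1 h2).2
      linarith
    | succ k hk ih =>
      obtain ⟨hconst, hVk⟩ := ih
      have hkR := hVR _ hVk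
      obtain ⟨hs1, hs2⟩ := hn₃ k (by omega)
      have hs3 := (hn₃ (k + 1) (by omega)).2
      have hzi : ∀ i, |z k i| ≤ R := fun i => (norm_le_pi_norm (z k) i).trans hkR
      have hu : ∀ i, |uBar ustar T k i| ≤ R + 1 := by
        intro i
        have h1 := abs_le.1 (hzi i)
        have h2 := abs_le.1 (hs2 i)
        have e : z k i = uBar ustar T k i + E k i := rfl
        exact abs_le.2 ⟨by linarith, by linarith⟩
      have hflow : ∀ i, |stepSize k * flow G (fun j => T.y j ((k + 1 : ℕ) : ℤ)) i| ≤ η := by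
        intro i
        rw [abs_mul, abs_of_nonneg (stepSize_nonneg k)]
        exact (mul_le_mul_of_nonneg_left (hP.flow_le k (by omega) i)
          (stepSize_nonneg k)).trans hs1
      have hσ : sigmaBar T (k + 1) = sigmaBar T k := by
        refine hT.sigmaBar_succ_eq (by omega) fun i => ?_
        rw [hconst k hk le_rfl]
        refine lt_of_le_of_lt ?_ (hn₄ m (by omega))
        have h1 := hP.tail_succ k i
        have h2 := abs_le.1 (hflow i)
        have h3 := abs_le.1 (hs2 i)
        have h4 := abs_le.1 (hs3 i)
        have h5 := abs_le.1 (hu i)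
        exact abs_le.2 ⟨by linarith, by linarith⟩
      have hconst' : ∀ s, τ ≤ s → s ≤ k + 1 → sigmaBar T s = m := by
        intro s h1 h2
        rcases Nat.lt_or_ge k s with h3 | h3
        · rw [show s = k + 1 by omega, hσ, hconst k hk le_rfl]
        · exact hconst s h1 h3
      refine ⟨hconst', ?_⟩
      rcases lt_or_ge (V (z k)) (V ustar + 1) with hlow | hhigh
      · have hd : dist (z k) (z (k + 1)) ≤ η₁ := by
          refine (dist_pi_le_iff hη₁.le).2 fun i => ?_
          rw [dist_comm, Real.dist_eq, hz, hP.corrected_succ hT (by omega) hσ i,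
            add_sub_cancel_left]
          split_ifs
          · have h3 := abs_le.1 (hs2 i)
            have h4 := abs_le.1 (hs3 i)
            exact abs_le.2 ⟨by linarith, by linarith⟩
          · exact (hflow i).trans (by linarith)
        have h1 := hmod (z k) (z (k + 1))
          (by rw [dist_zero_right]; exact hkR.trans (le_max_left _ _)) hd
        rw [dist_comm, Real.dist_eq] at h1
        have := (abs_le.1 h1).2
        linarith
      -- High potential cannot occur early, when `z` is within `2 η` of `u^*`. So all agents are
      -- informed throughout the window and the descent estimate applies.
      · have hlate : τ + G.diam < k - Nat.sqrt k := by
          by_contra! hcon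
          have hsk : Nat.sqrt k ≤ k := Nat.sqrt_le_self k
          have h1 := hstart k hk hconst (by omega)
          have h2 := hmod ustar (z k) (by simp) ((dist_pi_le_iff hη₁.le).2 fun i => by
            rw [dist_comm, Real.dist_eq]; exact (h1 i).trans (by linarith))
          rw [dist_comm, Real.dist_eq] at h2
          have := (abs_le.1 h2).2
          linarith
        have h1 := hn₁ k (by omega)
          (fun s hs1 hs2 => hinf s (by omega) fun r hr1 hr2 => hconst r hr1 (by omega))
          (fun s hs1 hs2 => by
            rw [hconst' (s + 1) (by omega) (by omega), hconst' s (by omega) (by omega)])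
          hu
        have h2 := hdiss (z k) hkR (hsum k (by omega) hconst) hhigh
        have h3 := mul_nonneg (stepSize_nonneg k) (sub_nonneg.2 h2)
        change V (z (k + 1)) ≤ V (z k) - _ at h1
        linarith
  obtain ⟨k₁, hk₁1, hk₁⟩ := hunb m
  have h1 := (hmain (max τ k₁) (le_max_left _ _)).1 (max τ k₁) (le_max_left _ _) le_rfl
  have h2 := hT.sigmaBar_mono hk₁1 (le_max_right τ k₁)
  omega

/-- The largest truncation number is eventually constant. -/
theorem RegularPath.exists_truncationsCease (hP : RegularPath G A ε T E Q)
    (hT : ClosedLoop G A ustar cM ε T) (hG : G.graph.Connected) :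
    ∃ m K, TruncationsCease T m K := by
  classical
  obtain ⟨b, hb⟩ := hP.exists_sigmaBar_le hT hG
  set p : ℕ → Prop := fun m => ∃ k, 1 ≤ k ∧ sigmaBar T k = m
  obtain ⟨k₀, hk₀, hk⟩ : p (Nat.findGreatest p b) :=
    Nat.findGreatest_spec (P := p) (hb 1 le_rfl) ⟨1, le_rfl, rfl⟩
  set m := Nat.findGreatest p b with hm
  have hex : ∃ k, 1 ≤ k ∧ ∀ l, k ≤ l → sigmaBar T l = m := by
    refine ⟨k₀, hk₀, fun l hl => le_antisymm ?_ (hk ▸ hT.sigmaBar_mono hk₀ hl)⟩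
    exact Nat.le_findGreatest (hb l (by omega)) ⟨l, by omega, rfl⟩
  exact ⟨m, Nat.find hex, Nat.find_spec hex, fun k hk => Nat.find_min' hex hk⟩

/-- By minimality of `K`, either `K = 1` and no truncation has occurred, or the maximum has just
increased at time `K` and `ū` has been reset. -/
lemma TruncationsCease.uBar_eq_restart {m K : ℕ} (h : TruncationsCease T m K)
    (hT : ClosedLoop G A ustar cM ε T) : uBar ustar T K = restart ustar T m := by
  obtain ⟨⟨hK1, hK⟩, hleast⟩ := h
  rcases Nat.eq_or_lt_of_le hK1 with rfl | hK2
  · have hm : m = 0 := by rw [← hK 1 le_rfl, hT.sigmaBar_one]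
    ext i
    simp [uBar, restart, hm, hT.sigmaBar_one]
  · obtain ⟨t, rfl⟩ : ∃ t, K = t + 1 := ⟨K - 1, by omega⟩
    have hne : sigmaBar T t ≠ m := by
      intro he
      have := hleast (show t ∈ {k : ℕ | 1 ≤ k ∧ ∀ l, k ≤ l → sigmaBar T l = m} from
        ⟨by omega, fun l hl => by
          rcases Nat.eq_or_lt_of_le hl with rfl | h
          · exact he
          · exact hK l h⟩)
      omega
    have hlt : sigmaBar T t < m := by
      have := hT.sigmaBar_le_succ (show 1 ≤ t by omega)
      rw [hK (t + 1) le_rfl] at this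
      omega
    rw [hT.uBar_succ_of_ne (by omega) (by rw [hK (t + 1) le_rfl]; exact hne.symm)]
    ext i
    rw [restart, if_neg (by omega)]

/-- The regression terms in `ε̄` have zero sum by conservation, and what remains is the increment of
`ū`; the sum telescopes. -/
lemma ClosedLoop.sum_uBar_eq (hT : ClosedLoop G A ustar cM ε T) {m K : ℕ}
    (h : TruncationsCease T m K) {n : ℕ} (hn : K ≤ n) :
    ∑ i, uBar ustar T n i = ∑ i, restart ustar T m i +
      ∑ s ∈ Finset.Ico K n, stepSize s * ∑ i, noiseBar G A ustar ε T s i := by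
  have hK1 : 1 ≤ K := h.1.1
  induction n, hn using Nat.le_induction with
  | base => simp [h.uBar_eq_restart hT]
  | succ n hn ih =>
    rw [Finset.sum_Ico_succ_top hn, ← add_assoc, ← ih]
    have hg : ∑ i, regression G A (uBar ustar T n) i = 0 := by
      simp only [regression_eq_flow, sum_flow]
    have e : ∑ i, noiseBar G A ustar ε T n i = ∑ i,
        if sigmaPrime G T i n < sigmaBar T n then 0 else innovation G ε T i (n + 1) := by
      simp only [noiseBar, Finset.sum_sub_distrib, hg, sub_zero]
    rw [e, Finset.mul_sum, ← Finset.sum_add_distrib]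
    refine Finset.sum_congr rfl fun i _ => ?_
    rw [hT.uBar_succ (by omega) (by rw [h.1.2 n hn, h.1.2 (n + 1) (by omega)])]
    split_ifs <;> simp

/-- Once truncations have ceased, the corrected inputs converge to the consensus point of their
hyperplane. -/
theorem RegularPath.exists_tendsto_u (hP : RegularPath G A ε T E Q)
    (hT : ClosedLoop G A ustar cM ε T) (hG : G.graph.Connected) (hcM : 0 < cM)
    (hustar : ∀ i, |ustar i| < bound cM 0) {m K : ℕ} (hK : TruncationsCease T m K) :
    ∃ (y₀ : ℝ) (u₀ : Fin N → ℝ), (∀ i, (A i).h (u₀ i) = y₀) ∧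
      (∀ i, Tendsto (fun k : ℕ => T.u i k) atTop (𝓝 (u₀ i))) ∧
      ∃ n₀, ∀ k, n₀ ≤ k → Informed T k := by
  obtain ⟨⟨hK1, hKm⟩, -⟩ := hK
  have hN := hG.nonempty
  have : NeZero N := ⟨(Fin.pos_iff_nonempty.2 hN).ne'⟩
  set h : Fin N → ℝ → ℝ := fun i => (A i).h with hh
  set V := potential h with hV
  set z := corrected ustar T E with hz
  have hinf : ∀ k, K + G.diam ≤ k → Informed T k := fun k hk =>
    hT.informed_of_const hG hK1 hk fun s h1 h2 => by rw [hKm s h1, hKm K le_rfl]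
  have hconst : ∀ k, K ≤ k → sigmaBar T (k + 1) = sigmaBar T k := fun k hk => by
    rw [hKm k hk, hKm (k + 1) (by omega)]
  set n₀ := K + G.diam + 1 with hn₀
  obtain ⟨u₀, y₀, hu₀, hsum₀⟩ := exists_common_value (h := h) hP.h_mono hP.h_surj (∑ i, z n₀ i)
  have hsum : ∀ k, n₀ ≤ k → ∑ i, z k i = ∑ i, u₀ i := by
    intro k hk
    induction k, hk using Nat.le_induction with
    | base => exact hsum₀.symm
    | succ k hk ih =>
      rw [← ih]
      exact hP.sum_corrected_succ hT (by omega) (hinf k (by omega)) (hconst k (by omega))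
  obtain ⟨n₁, hn₁1, hn₁⟩ := hP.exists_step_le one_pos
  -- With the truncation number frozen at `m`, the truncation rule itself bounds the inputs.
  set R := |bound cM m| with hR
  have hu : ∀ k, n₀ ≤ k → ∀ i, |uBar ustar T k i| ≤ R := by
    intro k hk i
    rw [(hinf k (by omega)).uBar_eq]
    obtain ⟨t, rfl⟩ : ∃ t, k = t + 1 := ⟨k - 1, by omega⟩
    have := hT.abs_u_succ_le hcM hustar i (show 1 ≤ t by omega)
    rw [hKm t (by omega)] at this
    exact this.le.trans (le_abs_self _)
  have hzR : ∀ k, n₀ + n₁ ≤ k → ‖z k‖ ≤ R + 1 := by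
    intro k hk
    refine (pi_norm_le_iff_of_nonneg (by positivity)).2 fun i => ?_
    exact (abs_add_le _ _).trans (add_le_add (hu k (by omega) i) ((hn₁ k (by omega)).2 i))
  have hVlim : ∀ η : ℝ, 0 < η → ∃ n, ∀ k, n ≤ k → V (z k) ≤ V u₀ + η + η := by
    intro η hη
    obtain ⟨α, hα, hdiss⟩ := exists_dissipation_lower_bound_of_hyperplane hG hP.h_cont hP.h_mono
      (u := u₀) (R + 1) hη
    -- An error of `α / 2` leaves a decrease of at least `a_k α / 2` per step, which the divergence
    -- of `∑ a_k` turns into convergence.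
    obtain ⟨n₂, hn₂⟩ := hP.exists_corrected_descent hT (R := R) (abs_nonneg _) (half_pos hα)
    obtain ⟨d, hd, hmod⟩ := exists_uniform_modulus (continuous_potential hP.h_cont) 0 (R + 1) hη
    obtain ⟨n₃, hn₃1, hn₃⟩ := hP.exists_step_le hd
    refine eventually_le_of_descent (n₀ := 2 * n₀ + n₁ + n₂ + n₃ + 4) (half_pos hα)
      (fun k hk hhigh => ?_) fun k hk hlow => ?_
    · have hsq : 2 * Nat.sqrt k ≤ k := by
        have h1 : Nat.sqrt k * Nat.sqrt k ≤ k := Nat.sqrt_le k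
        have h2 : 2 ≤ Nat.sqrt k := Nat.le_sqrt.2 (by omega)
        nlinarith
      have h1 := hn₂ k (by omega) (fun s hs1 hs2 => hinf s (by omega))
        (fun s hs1 hs2 => hconst s (by omega)) (hu k (by omega))
      have h2 := hdiss (z k) (hzR k (by omega)) (hsum k (by omega)) hhigh
      have h3 := mul_nonneg (stepSize_nonneg k) (sub_nonneg.2 h2)
      change V (z (k + 1)) ≤ V (z k) - _ at h1
      linarith
    · have hdist : dist (z k) (z (k + 1)) ≤ d := by
        refine (dist_pi_le_iff hd.le).2 fun i => ?_
        rw [dist_comm, Real.dist_eq, hz,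
          hP.corrected_succ_of_informed hT (by omega) (hinf k (by omega)) (hconst k (by omega)) i,
          add_sub_cancel_left, abs_mul, abs_of_nonneg (stepSize_nonneg k)]
        exact (mul_le_mul_of_nonneg_left (hP.flow_le k (by omega) i)
          (stepSize_nonneg k)).trans (hn₃ k (by omega)).1
      have h1 := hmod (z k) (z (k + 1)) (by rw [dist_zero_right]; exact hzR k (by omega)) hdist
      rw [dist_comm, Real.dist_eq] at h1
      have := (abs_le.1 h1).2
      linarith
  have hzlim : Tendsto z atTop (𝓝 u₀) := by
    refine Metric.tendsto_atTop.2 fun η hη => ?_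
    obtain ⟨κ, hκ, hgap⟩ := exists_potential_gap hP.h_cont hP.h_mono hu₀ (R + 1) hη
    obtain ⟨n, hn⟩ := hVlim (κ / 4) (by positivity)
    refine ⟨max n (n₀ + n₁), fun k hk => ?_⟩
    rw [dist_eq_norm]
    refine hgap (z k) (hzR k (by omega)) (hsum k (by omega)) ?_
    have := hn k (by omega)
    linarith
  refine ⟨y₀, u₀, hu₀, fun i => ?_, n₀, fun k hk => hinf k (by omega)⟩
  have h1 := (hzlim.sub hP.tail_lim)
  rw [sub_zero] at h1
  refine ((tendsto_pi_nhds.1 h1) i).congr' ?_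
  filter_upwards [eventually_ge_atTop n₀] with k hk
  simp only [Pi.sub_apply, hz, corrected, (hinf k (by omega)).uBar_eq, add_sub_cancel_right]

/-- A convergent input is eventually nearly constant on windows of length `√k`, since they begin
after time `k / 2`. -/
lemma Tracks.tendsto {h : ℝ → ℝ} (hc : Continuous h) {u y : ℕ → ℝ} (htr : Tracks h u y)
    {u₀ : ℝ} (hu : Tendsto u atTop (𝓝 u₀)) : Tendsto y atTop (𝓝 (h u₀)) := by
  have hdiff : Tendsto (fun k => y (k + 1) - h (u k)) atTop (𝓝 0) := by
    refine Metric.tendsto_atTop.2 fun η hη => ?_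
    obtain ⟨δ, hδ, n₀, h1⟩ := htr (|u₀| + 1) (η / 2) (half_pos hη)
    obtain ⟨n₁, hn₁⟩ := Metric.tendsto_atTop.1 hu (min (δ / 2) 1) (by positivity)
    refine ⟨n₀ + 2 * n₁ + 4, fun k hk => ?_⟩
    have hsq : 2 * Nat.sqrt k ≤ k := by
      have h1 : Nat.sqrt k * Nat.sqrt k ≤ k := Nat.sqrt_le k
      have h2 : 2 ≤ Nat.sqrt k := Nat.le_sqrt.2 (by omega)
      nlinarith
    have hk0 := hn₁ k (by omega)
    rw [Real.dist_eq] at hk0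
    rw [Real.dist_eq, sub_zero]
    refine (h1 k (by omega) ?_ fun s hs1 hs2 => ?_).trans_lt (by linarith)
    · have h2 := abs_sub_abs_le_abs_sub (u k) u₀
      have h3 := min_le_right (δ / 2) 1
      linarith
    · have hs0 := hn₁ s (by omega)
      rw [Real.dist_eq] at hs0
      have h3 := min_le_left (δ / 2) 1
      have h4 := abs_sub_le (u s) u₀ (u k)
      rw [abs_sub_comm u₀] at h4
      linarith
  refine (tendsto_add_atTop_iff_nat 1).1 ?_
  have := hdiff.add ((hc.tendsto u₀).comp hu)
  simpa using this

/-- The asymptotic behavior of a single trajectory. -/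
theorem RegularPath.consensus (hP : RegularPath G A ε T E Q)
    (hT : ClosedLoop G A ustar cM ε T) (hG : G.graph.Connected) (hcM : 0 < cM)
    (hustar : ∀ i, |ustar i| < bound cM 0) :
    ∃ (y₀ : ℝ) (u₀ : Fin N → ℝ), (∀ i, Tendsto (fun k : ℕ => T.y i k) atTop (𝓝 y₀)) ∧
      (∀ i, Tendsto (fun k : ℕ => T.u i k) atTop (𝓝 (u₀ i))) ∧
      (∀ i, (A i).h (u₀ i) = y₀) ∧
      ∃ (m K : ℕ) (S : ℝ), TruncationsCease T m K ∧
        Tendsto (fun n : ℕ => ∑ s ∈ Finset.Ico K n, stepSize s *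
          ∑ i, noiseBar G A ustar ε T s i) atTop (𝓝 S) ∧
        {w : Fin N → ℝ | regression G A w = 0 ∧
          ∑ i, w i = ∑ i, restart ustar T m i + S} = {u₀} := by
  obtain ⟨m, K, hK⟩ := hP.exists_truncationsCease hT hG
  obtain ⟨y₀, u₀, hu₀, hlim, n₀, hinf⟩ := hP.exists_tendsto_u hT hG hcM hustar hK
  have hN := hG.nonempty
  have : NeZero N := ⟨(Fin.pos_iff_nonempty.2 hN).ne'⟩
  -- Convergence of the noise series is a consequence of `u → u₀`: its partial sums are `1ᵀū_n`
  -- minus the restart sum, which dictates the value of `S`.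
  refine ⟨y₀, u₀, fun i => ?_, hlim, hu₀, m, K, ∑ i, u₀ i - ∑ i, restart ustar T m i, hK, ?_, ?_⟩
  · rw [← hu₀ i]
    exact (hP.tracks i).tendsto (hP.h_cont i) (hlim i)
  · have h1 : Tendsto (fun n : ℕ => ∑ i, T.u i n - ∑ i, restart ustar T m i) atTop
        (𝓝 (∑ i, u₀ i - ∑ i, restart ustar T m i)) :=
      (tendsto_finsetSum _ fun i _ => hlim i).sub_const _
    refine h1.congr' ?_
    filter_upwards [eventually_ge_atTop (max n₀ K)] with n hn
    have h2 := hT.sum_uBar_eq hK (show K ≤ n by omega)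
    rw [(hinf n (by omega)).uBar_eq] at h2
    linarith
  · ext w
    simp only [Set.mem_ofPred_eq, Set.mem_singleton_iff, add_sub_cancel]
    constructor
    · rintro ⟨hw, hsum⟩
      have hf : flow G (fun j => (A j).h (w j)) = 0 := by
        ext i
        rw [← regression_eq_flow, hw]
      obtain ⟨i₀⟩ := hN
      exact common_value_unique (h := fun i => (A i).h) hP.h_mono hu₀
        (fun i => eq_of_flow_eq_zero G hG hf i i₀) hsum
    · rintro rfl
      refine ⟨?_, rfl⟩
      ext i
      rw [regression_eq_flow]
      simp [flow, hu₀]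

lemma Agent.continuous_h {A : Agent} (hf : Continuous A.f) : Continuous A.h := by
  rcases A with ⟨_ | _, C, D, f, hC, hD⟩ <;> simp only at hf
  · exact continuous_const.mul hf
  · exact hf.comp (continuous_const.mul continuous_id)

/-- A trajectory whose accumulated noise converges along every edge is regular. -/
theorem ClosedLoop.exists_regularPath (hT : ClosedLoop G A ustar cM ε T)
    (hA1 : ∀ i, (A i).Stable) (hA2_cont : ∀ i, Continuous (A i).f)
    (hA2_growth : ∃ ρ : ℝ, 0 < ρ ∧ ∀ i, (A i).f =O[cocompact ℝ] fun x : ℝ => |x| ^ ρ)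
    (hA2_mono : ∀ i, StrictMono (A i).h) (hA2_range : ∀ i, Set.range (A i).h = Set.univ)
    (hcM : 0 < cM) (hustar : ∀ i, |ustar i| < bound cM 0)
    (hε : ∀ i j, G.graph.Adj i j → ∃ l, Tendsto (fun n => ∑ s ∈ Finset.range n,
      stepSize s * ε i j (s + 1)) atTop (𝓝 l)) :
    ∃ E Q, RegularPath G A ε T E Q := by
  obtain ⟨ρ, hρ, hfρ⟩ := hA2_growth
  have hgrow := fun i => (hT.dynamics i).growth (hA1 i) (hA2_cont i) hρ (hfρ i)
    fun θ hθ => hT.u_growth hcM hustar i hθ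
  have hex : ∀ i, ∃ l, Tendsto (fun n => ∑ s ∈ Finset.range n,
      stepSize s * ∑ j ∈ G.nbrs i, G.P i j * ε i j (s + 1)) atTop (𝓝 l) := by
    intro i
    have h1 : ∀ j ∈ G.nbrs i, ∃ l, Tendsto (fun n => ∑ s ∈ Finset.range n,
        stepSize s * ε i j (s + 1)) atTop (𝓝 l) := fun j hj =>
      hε i j (by simpa [Network.nbrs] using hj)
    choose! l hl using h1
    refine ⟨∑ j ∈ G.nbrs i, G.P i j * l j, ?_⟩
    refine (tendsto_finsetSum _ fun j hj => (hl j hj).const_mul (G.P i j)).congr fun n => ?_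
    simp only [Finset.mul_sum]
    rw [Finset.sum_comm]
    exact Finset.sum_congr rfl fun s _ => Finset.sum_congr rfl fun j _ => by ring
  choose l hl using hex
  choose B hB0 hB using fun i => (hgrow i).1
  set b := ∑ i, B i with hb
  have hb0 : 0 ≤ b := Finset.sum_nonneg fun i _ => hB0 i
  set p := ∑ i, ∑ j, G.P i j with hp
  have hPnn := G.P_nonneg
  have hp0 : 0 ≤ p := Finset.sum_nonneg fun i _ => Finset.sum_nonneg fun j _ => hPnn i j
  -- `E` is the tail of the noise series weighted over the neighbors. In `Q`, a factor `2` comes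
  -- from `(k + 1) ^ (1/4) ≤ 2 k ^ (1/4)` and another from the difference of two outputs.
  refine ⟨fun k i => l i - ∑ s ∈ Finset.range k,
    stepSize s * ∑ j ∈ G.nbrs i, G.P i j * ε i j (s + 1), p * (4 * b), ?_⟩
  refine ⟨fun i => Agent.continuous_h (hA2_cont i), hA2_mono,
    fun i => Set.range_eq_univ.1 (hA2_range i), ?_, fun k i => ?_, by positivity,
    fun k hk i => ?_, fun i R η hη => ?_⟩
  · refine tendsto_pi_nhds.2 fun i => ?_
    simpa using (hl i).const_sub (l i)
  · have e : innovation G ε T i (k + 1) - flow G (fun j => T.y j ((k + 1 : ℕ) : ℤ)) i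
        = ∑ j ∈ G.nbrs i, G.P i j * ε i j (k + 1) := by
      rw [innovation, flow, ← Finset.sum_sub_distrib]
      exact Finset.sum_congr rfl fun j _ => by rw [observed]; ring
    rw [e, Finset.sum_range_succ]
    ring
  · set t := (k : ℝ) ^ (1 / 4 : ℝ) with ht
    have hk0 : (1 : ℝ) ≤ k := by exact_mod_cast hk
    have hk1 : ((k + 1 : ℕ) : ℝ) ^ (1 / 4 : ℝ) ≤ 2 * t := by
      calc ((k + 1 : ℕ) : ℝ) ^ (1 / 4 : ℝ) ≤ (2 * k : ℝ) ^ (1 / 4 : ℝ) := by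
            gcongr
            push_cast
            linarith
        _ = 2 ^ (1 / 4 : ℝ) * t := by rw [Real.mul_rpow (by norm_num) (by positivity)]
        _ ≤ 2 ^ (1 : ℝ) * t := by
            gcongr
            · norm_num
            · norm_num
        _ = 2 * t := by rw [Real.rpow_one]
    have hyb : ∀ j, |T.y j ((k + 1 : ℕ) : ℤ)| ≤ 2 * b * t := by
      intro j
      have hBb : B j ≤ b := Finset.single_le_sum (f := B) (fun i _ => hB0 i) (Finset.mem_univ j)
      calc _ ≤ B j * ((k + 1 : ℕ) : ℝ) ^ (1 / 4 : ℝ) := hB j (k + 1) (by omega)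
        _ ≤ b * (2 * t) := by gcongr
        _ = _ := by ring
    rw [flow_eq_sum]
    calc _ ≤ ∑ j, |G.P i j * (T.y j ((k + 1 : ℕ) : ℤ) - T.y i ((k + 1 : ℕ) : ℤ))| :=
          Finset.abs_sum_le_sum_abs _ _
      _ ≤ ∑ j, G.P i j * (4 * b * t) := by
          refine Finset.sum_le_sum fun j _ => ?_
          rw [abs_mul, abs_of_nonneg (hPnn i j)]
          refine mul_le_mul_of_nonneg_left ?_ (hPnn i j)
          have h1 := abs_le.1 (hyb i)
          have h2 := abs_le.1 (hyb j)
          exact abs_le.2 ⟨by linarith, by linarith⟩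
      _ = (∑ j, G.P i j) * (4 * b * t) := by rw [Finset.sum_mul]
      _ ≤ p * (4 * b * t) := by
          gcongr
          exact Finset.single_le_sum (f := fun i => ∑ j, G.P i j)
            (fun i _ => Finset.sum_nonneg fun j _ => hPnn i j) (Finset.mem_univ i)
      _ = _ := by ring
  · obtain ⟨δ, hδ, n₀, h1⟩ := (hT.dynamics i).tracking (hA1 i) (hA2_cont i) (hgrow i).1
      (hgrow i).2 R hη
    refine ⟨δ, hδ, n₀, fun k hk huk hwin => ?_⟩
    have := h1 k hk huk hwin
    exact_mod_cast this

end RegularPaths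

end NetConsensus

/-! ### Almost sure statement and measurable limits -/

theorem theorem1 {Ω : Type*} [MeasurableSpace Ω] (μ : Measure Ω) [IsProbabilityMeasure μ]
    {N : ℕ} (G : NetConsensus.Network N) (A : Fin N → NetConsensus.Agent)
    (ustar : Fin N → ℝ) (cM : ℝ) (ε : Fin N → Fin N → ℕ → Ω → ℝ)
    (T : Ω → NetConsensus.Trajectory N)
    -- A1: the linear parts are stable
    (hA1 : ∀ i, (A i).Stable)
    -- A2: the nonlinearities are continuous and of at most polynomial growth;
    -- the functions `h_i` are strictly increasing with range `ℝ`
    (hA2_cont : ∀ i, Continuous (A i).f)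
    (hA2_growth : ∃ ρ : ℝ, 0 < ρ ∧
      ∀ i, (A i).f =O[cocompact ℝ] fun x : ℝ => |x| ^ ρ)
    (hA2_mono : ∀ i, StrictMono (A i).h)
    (hA2_range : ∀ i, Set.range (A i).h = Set.univ)
    -- A3: the observation noises are mutually independent, centered, with bounded second moments
    (hA3_meas : ∀ i j (k : ℕ), G.graph.Adj i j → 1 ≤ k → Measurable (ε i j k))
    (hA3_indep : iIndepFun
      (fun (e : {e : Fin N × Fin N × ℕ // G.graph.Adj e.1 e.2.1 ∧ 1 ≤ e.2.2}) =>
        ε e.1.1 e.1.2.1 e.1.2.2) μ)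
    (hA3_mean : ∀ i j (k : ℕ), G.graph.Adj i j → 1 ≤ k →
      MemLp (ε i j k) 2 μ ∧ ∫ ω, ε i j k ω ∂μ = 0)
    (hA3_var : ∀ i j, G.graph.Adj i j →
      ∃ B : ℝ, ∀ k : ℕ, 1 ≤ k → ∫ ω, |ε i j k ω| ^ 2 ∂μ ≤ B)
    -- A4: the graph is connected
    (hA4 : G.graph.Connected)
    -- the truncation parameters
    (hcM : 0 < cM) (hustar : ∀ i, |ustar i| < NetConsensus.bound cM 0)
    -- the closed-loop signals are random variables generated by the systems and the algorithm
    (hu : ∀ i k, Measurable fun ω => (T ω).u i k)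
    (hy : ∀ i k, Measurable fun ω => (T ω).y i k)
    (hT : ∀ ω, NetConsensus.ClosedLoop G A ustar cM (fun i j k => ε i j k ω) (T ω)) :
    ∃ (y0 : Ω → ℝ) (u0 : Ω → Fin N → ℝ), Measurable y0 ∧ Measurable u0 ∧ ∀ᵐ ω ∂μ,
      -- all outputs converge to the same limit
      (∀ i, Tendsto (fun k : ℕ => (T ω).y i k) atTop (𝓝 (y0 ω))) ∧
      -- the inputs converge to `u0`, and `y0 • 1 = h(u0)`
      (∀ i, Tendsto (fun k : ℕ => (T ω).u i k) atTop (𝓝 (u0 ω i))) ∧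
      (∀ i, (A i).h (u0 ω i) = y0 ω) ∧
      -- `u0` is the only root of `g` on the hyperplane given by the accumulated noise
      ∃ (m K : ℕ) (S : ℝ), NetConsensus.TruncationsCease (T ω) m K ∧
        Tendsto (fun n : ℕ => ∑ s ∈ Finset.Ico K n, NetConsensus.stepSize s *
          ∑ i, NetConsensus.noiseBar G A ustar (fun i j k => ε i j k ω) (T ω) s i)
          atTop (𝓝 S) ∧
        {w : Fin N → ℝ | NetConsensus.regression G A w = 0 ∧
          ∑ i, w i = ∑ i, NetConsensus.restart ustar (T ω) m i + S} = {u0 ω} := by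

  have hnoise : ∀ᵐ ω ∂μ, ∀ i j, G.graph.Adj i j → ∃ l, Tendsto (fun n => ∑ s ∈ Finset.range n,
      NetConsensus.stepSize s * ε i j (s + 1) ω) atTop (𝓝 l) := by
    refine ae_all_iff.2 fun i => ae_all_iff.2 fun j =>
      Filter.eventually_imp_distrib_left.2 fun hij => ?_
    obtain ⟨B, hB⟩ := hA3_var i j hij
    refine NetConsensus.ae_exists_tendsto_noise (fun k hk => hA3_meas i j k hij hk) ?_
      (fun k hk => hA3_mean i j k hij hk) hB
    exact hA3_indep.precomp (g := fun k : {k : ℕ // 1 ≤ k} =>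
      (⟨(i, j, k.1), hij, k.2⟩ : {e : Fin N × Fin N × ℕ // G.graph.Adj e.1 e.2.1 ∧ 1 ≤ e.2.2}))
      fun a b h => by simpa [Subtype.ext_iff] using h
  have hmain : ∀ᵐ ω ∂μ, _ := hnoise.mono fun ω hω =>
    let ⟨_, _, hP⟩ := (hT ω).exists_regularPath hA1 hA2_cont hA2_growth hA2_mono hA2_range hcM
      hustar hω
    hP.consensus (hT ω) hA4 hcM hustar
  obtain ⟨i₀⟩ := hA4.nonempty
  -- The pathwise limits are chosen separately for each sample; measurable versions are taken as
  -- almost sure limits of measurable signals and identified with them by uniqueness of limits. All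
  -- outputs share one limit, so agent `i₀` suffices for `y0`.
  obtain ⟨y0, hy0, hylim⟩ := measurable_limit_of_tendsto_metrizable_ae (μ := μ)
    (L := atTop) (f := fun (k : ℕ) ω => (T ω).y i₀ k) (fun k => (hy i₀ k).aemeasurable)
    (hmain.mono fun ω ⟨y, _, h, _⟩ => ⟨y, h i₀⟩)
  obtain ⟨u0, hu0, hulim⟩ := measurable_limit_of_tendsto_metrizable_ae (μ := μ)
    (L := atTop) (f := fun (k : ℕ) ω (i : Fin N) => (T ω).u i k)
    (fun k => (measurable_pi_iff.2 fun i => hu i k).aemeasurable)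
    (hmain.mono fun ω ⟨_, u, _, h, _⟩ => ⟨u, tendsto_pi_nhds.2 h⟩)
  refine ⟨y0, u0, hy0, hu0, ?_⟩
  filter_upwards [hmain, hylim, hulim] with ω ⟨y, u, h1, h2, h3⟩ hyω huω
  obtain rfl : y = y0 ω := tendsto_nhds_unique (h1 i₀) hyω
  obtain rfl : u = u0 ω := tendsto_nhds_unique (tendsto_pi_nhds.2 h2) huω
  exact ⟨h1, h2, h3⟩
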